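/- Let $d,n\in\mathbb N$, $y\in\mathbb R^n$, and let $p(y|x)>0$ ($x\in\mathbb R^d$) be a forward model (likelihood) such that for every $y$ the function $p(y|\cdot)$ is bounded and of class $C^1$ and $\nabla\log p(y|\cdot)$ is $L$-Lipschitz, with $L>0$ independent of $y$ (for instance $p(y|x)\propto\exp(-\|y-Ax\|^2/(2\sigma^2))$). Let $m\in\mathbb R$ be such that, at the given observation $y$, $\langle\nabla\log p(y|x_2)-\nabla\log p(y|x_1),x_2-x_1\rangle\le -m\|x_2-x_1\|^2$ for all $x_1,x_2\in\mathbb R^d$. Let $\mathbb S\subset\mathbb R^d$ be nonempty, convex and compact, with orthogonal projection $\Pi_{\mathbb S}$, let $\varepsilon>0$, $M\ge 0$, and let $\lambda>0$ satisfy $2\lambda\bigl(L+\frac{M+1}{\varepsilon}-\min(m,0)\bigr)\le 1$. For a denoiser $D:\mathbb R^d\to\mathbb R^d$ put $$b_D(x)=\nabla\log p(y|x)+\tfrac1\varepsilon\,(D(x)-x)+\tfrac1\lambda\,(\Pi_{\mathbb S}(x)-x),$$ and for $\delta>0$ consider the PnP-ULA Markov chain $x_{k+1}=x_k+\delta\,b_D(x_k)+\sqrt{2\delta}\,z_{k+1}$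 with i.i.d. $z_k\sim\mathcal N(0,I_d)$. Let $\bar\delta=\frac13\bigl(L+\frac{M+1}{\varepsilon}+\frac1\lambda\bigr)^{-1}$. Then there exist constants $A_0,A_2,B_2\ge 0$ with $A_2=A_0/\varepsilon$ such that for all $\delta\in(0,\bar\delta]$, all $M$-Lipschitz denoisers $D^1,D^2$ and all invariant probability measures $\pi^1,\pi^2$ of the chains with drifts $b_{D^1},b_{D^2}$ and step size $\delta$, the function $\|D^1-D^2\|^2$ is $\pi^1$-integrable and $$\|\pi^1-\pi^2\|_{TV}\le A_0\,d_1(b_{D^1},b_{D^2})+B_2\,\delta^{1/4},\qquad \|\pi^1-\pi^2\|_{TV}\le A_2\,d_1(D^1,D^2)+B_2\,\delta^{1/4},$$ where $d_1(f,g)=\bigl(\mathbb E_{X\sim\pi^1}\|f(X)-g(X)\|^2\bigr)^{1/2}$ and $\|\pi^1-\pi^2\|_{TV}=\sup_{\|f\|_\infty\le1}\bigl|\int f\,d\pi^1-\int f\,d\pi^2\bigr|$. -/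

import Mathlib

open MeasureTheory ProbabilityTheory Set
open scoped ENNReal Gradient

noncomputable section

namespace PnPULA

variable {n d : ℕ}

/-- A nearest point of `S` to `x`. If `S` is nonempty, convex and compact there is exactly one,
the orthogonal projection of `x` onto `S`. (If there is none the value is `x`.) -/
def proj (S : Set (EuclideanSpace ℝ (Fin d))) (x : EuclideanSpace ℝ (Fin d)) :
    EuclideanSpace ℝ (Fin d) :=
  open Classical in
  if h : ∃ z ∈ S, ∀ w ∈ S, dist x z ≤ dist x w then h.choose else x

/-- The score `x ↦ ∇ₓ log p(y|x)` of the likelihood. -/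
def likScore (p : EuclideanSpace ℝ (Fin n) → EuclideanSpace ℝ (Fin d) → ℝ)
    (y : EuclideanSpace ℝ (Fin n)) (x : EuclideanSpace ℝ (Fin d)) : EuclideanSpace ℝ (Fin d) :=
  ∇ (fun u => Real.log (p y u)) x

/-- The forward model `p(y|x)` is positive, bounded in `x` and of class `C¹` in `x`, and the
gradient of its logarithm is `L`-Lipschitz with a constant that does not depend on `y`. -/
structure SmoothForwardModel
    (p : EuclideanSpace ℝ (Fin n) → EuclideanSpace ℝ (Fin d) → ℝ) (L : ℝ) : Prop where
  pos : ∀ y x, 0 < p y x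
  bounded : ∀ y, BddAbove (range (p y))
  contDiff : ∀ y, ContDiff ℝ 1 (p y)
  lipschitz : ∀ y x₁ x₂, ‖likScore p y x₁ - likScore p y x₂‖ ≤ L * ‖x₁ - x₂‖

/-- One-sided Lipschitz bound (`m`-concavity, for `m > 0`) of the log-likelihood at `y`. -/
def LikelihoodMonotone (p : EuclideanSpace ℝ (Fin n) → EuclideanSpace ℝ (Fin d) → ℝ)
    (y : EuclideanSpace ℝ (Fin n)) (m : ℝ) : Prop :=
  ∀ x₁ x₂, inner ℝ (likScore p y x₂ - likScore p y x₁) (x₂ - x₁) ≤ -m * ‖x₂ - x₁‖ ^ 2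

/-- `D` is a denoiser with Lipschitz constant `M`. -/
def LipschitzDenoiser (D : EuclideanSpace ℝ (Fin d) → EuclideanSpace ℝ (Fin d)) (M : ℝ) : Prop :=
  ∀ x₁ x₂, ‖D x₁ - D x₂‖ ≤ M * ‖x₁ - x₂‖

/-- The drift `∇ log p(y|x) + (D x - x) / ε + (Π_S x - x) / lam` of PnP-ULA. -/
def drift (p : EuclideanSpace ℝ (Fin n) → EuclideanSpace ℝ (Fin d) → ℝ)
    (y : EuclideanSpace ℝ (Fin n)) (S : Set (EuclideanSpace ℝ (Fin d))) (lam ε : ℝ)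
    (D : EuclideanSpace ℝ (Fin d) → EuclideanSpace ℝ (Fin d)) (x : EuclideanSpace ℝ (Fin d)) :
    EuclideanSpace ℝ (Fin d) :=
  likScore p y x + (1 / ε) • (D x - x) + (1 / lam) • (proj S x - x)

/-- One-step transition of the chain `x_{k+1} = x_k + δ b(x_k) + √(2δ) z_{k+1}`: the law of
`x + δ b(x) + √(2δ) z` for a standard Gaussian vector `z`. -/
def transition (b : EuclideanSpace ℝ (Fin d) → EuclideanSpace ℝ (Fin d)) (δ : ℝ)
    (x : EuclideanSpace ℝ (Fin d)) : Measure (EuclideanSpace ℝ (Fin d)) :=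
  (stdGaussian (EuclideanSpace ℝ (Fin d))).map
    (fun z => x + δ • b x + Real.sqrt (2 * δ) • z)

/-- `π` is an invariant probability law of the chain with drift `b` and step size `δ`. -/
def IsInvariantLaw (b : EuclideanSpace ℝ (Fin d) → EuclideanSpace ℝ (Fin d)) (δ : ℝ)
    (π : Measure (EuclideanSpace ℝ (Fin d))) : Prop :=
  IsProbabilityMeasure π ∧
    ∀ s, MeasurableSet s → ∫⁻ x, transition b δ x s ∂π = π s

/-- `‖μ - ν‖_TV`, the supremum of `|∫ f dμ - ∫ f dν|` over measurable `f` with `|f| ≤ 1`. -/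
def tvDist (μ ν : Measure (EuclideanSpace ℝ (Fin d))) : ℝ :=
  sSup {r | ∃ f : EuclideanSpace ℝ (Fin d) → ℝ, Measurable f ∧ (∀ x, |f x| ≤ 1) ∧
    r = |∫ x, f x ∂μ - ∫ x, f x ∂ν|}

/-- The posterior-`L²` pseudometric `(E_{X ∼ π} ‖f(X) - g(X)‖²)^{1/2}`. -/
def d₁ (π : Measure (EuclideanSpace ℝ (Fin d)))
    (f g : EuclideanSpace ℝ (Fin d) → EuclideanSpace ℝ (Fin d)) : ℝ :=
  Real.sqrt (∫ x, ‖f x - g x‖ ^ 2 ∂π)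

/-- The largest step size `δ̄ = (L + (M + 1) / ε + 1 / lam)⁻¹ / 3`. -/
def maxStep (L M ε lam : ℝ) : ℝ := 1 / 3 * (L + (M + 1) / ε + 1 / lam)⁻¹

end PnPULA

end

/-! Write `P₁`, `P₂` for the transition operators, `Tᵢ x = x + δ bᵢ x`. Invariance of `π₁` gives `∫
P₂ᵏφ dπ₁ - ∫ P₂ᵏ⁺¹φ dπ₁ = ∫ (P₁ - P₂) P₂ᵏφ dπ₁`: changing the drift at one step costs the Lipschitz
constant of a Gaussian average of `P₂ᵏφ` times `∫ ‖T₁ - T₂‖ dπ₁`. Let `W` be the distance dual to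
functions of oscillation at most `1 + β‖x - y‖`. If `P₂ᴺ` contracts it by `γ < 1`, telescoping
yields `W ≤ S ∫ ‖T₁ - T₂‖ dπ₁ + γ W`, with `S` the sum of these constants over `k < N`. Invariant
laws have second moments, so `W` is finite and can be absorbed; total variation is at most `2 W`.

Uniformity in `δ` rests on `log_harnack`: over a bounded time `kδ`, noise makes a `[0, 1]`-valued
function Lipschitz with constant of order `(δ(k+1))^(-1/2)`. Since `‖T₁ - T₂‖ = δ‖b₁ - b₂‖` and `δ ∑
(δ(k+1))^(-1/2) ≤ 2√(Nδ)`, the cost of `N` of order `1/δ` steps stays bounded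
(`mul_sum_smoothLip_le`). No discretisation error appears, so `B₂ = 0` works.

The contraction is of Harris type (`OscClass.abs_iterate_sub_le`): the pull towards `S` contracts
large distances, and at bounded distance the same Harnack inequality makes the laws overlap. -/

namespace GaussianChain

/-! ### Gaussian density, translation and entropy -/

section Gaussian

variable {E : Type*} [NormedAddCommGroup E] [InnerProductSpace ℝ E] [FiniteDimensional ℝ E]
  [MeasurableSpace E] [BorelSpace E]

lemma integrable_exp_neg_sq_norm : Integrable (fun v : E => Real.exp (-(1 / 2) * ‖v‖ ^ 2)) := by
  have h := GaussianFourier.integrable_cexp_neg_mul_sq_norm_add (V := E) (b := 1 / 2)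
    (by norm_num) 0 0
  refine h.norm.congr (ae_of_all _ fun v => ?_)
  simp only [Complex.norm_exp]
  congr 1
  have : (-(1 / 2 : ℂ) * (‖v‖ : ℂ) ^ 2 + 0 * ((inner ℝ (0 : E) v : ℝ) : ℂ))
    = ((-(1 / 2) * ‖v‖ ^ 2 : ℝ) : ℂ) := by push_cast; ring
  rw [this, Complex.ofReal_re]

/-- The standard Gaussian measure has the expected density with respect to Lebesgue measure. -/
lemma stdGaussian_eq_withDensity : ∃ c : ℝ, 0 < c ∧ stdGaussian E =
    volume.withDensity (fun v : E => ENNReal.ofReal (c * Real.exp (-(1 / 2) * ‖v‖ ^ 2))) := by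
  set Z : ℝ := ∫ v : E, Real.exp (-(1 / 2) * ‖v‖ ^ 2) with hZ
  have hZe : Z = (Real.pi / (1 / 2)) ^ (Module.finrank ℝ E / 2 : ℝ) :=
    GaussianFourier.integral_rexp_neg_mul_sq_norm (V := E) (b := 1 / 2) (by norm_num)
  have hZpos : 0 < Z := by rw [hZe]; positivity
  have hZc : (Z : ℂ) = ((Real.pi : ℂ) / (1 / 2)) ^ (Module.finrank ℝ E / 2 : ℂ) := by
    rw [hZe, Complex.ofReal_cpow (by positivity)]
    push_cast
    rfl
  have hmeas : Measurable (fun v : E => ENNReal.ofReal (Z⁻¹ * Real.exp (-(1 / 2) * ‖v‖ ^ 2))) := by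
    fun_prop
  refine ⟨Z⁻¹, by positivity, ?_⟩
  have : IsFiniteMeasure (volume.withDensity
      (fun v : E => ENNReal.ofReal (Z⁻¹ * Real.exp (-(1 / 2) * ‖v‖ ^ 2)))) :=
    isFiniteMeasure_withDensity_ofReal (integrable_exp_neg_sq_norm.const_mul _).2
  apply Measure.ext_of_charFun
  ext t
  rw [charFun_stdGaussian, charFun_apply,
    integral_withDensity_eq_integral_toReal_smul hmeas (ae_of_all _ fun _ => ENNReal.ofReal_lt_top)]
  have hint := GaussianFourier.integral_cexp_neg_mul_sq_norm_add (V := E) (b := 1 / 2)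
    (by norm_num) Complex.I t
  have : ∀ v : E, (ENNReal.ofReal (Z⁻¹ * Real.exp (-(1 / 2) * ‖v‖ ^ 2))).toReal •
      Complex.exp ((inner ℝ v t : ℝ) * Complex.I) =
      (Z : ℂ)⁻¹ * Complex.exp (-(1 / 2) * (‖v‖ : ℂ) ^ 2 + Complex.I * (inner ℝ t v : ℝ)) := by
    intro v
    rw [ENNReal.toReal_ofReal (by positivity), Complex.exp_add, Complex.real_smul]
    push_cast
    rw [real_inner_comm, mul_comm Complex.I]
    ring
  simp_rw [this]
  rw [integral_const_mul, hint, ← hZc, ← mul_assoc, inv_mul_cancel₀ (by exact_mod_cast hZpos.ne'),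
    one_mul, Complex.I_sq]
  congr 1
  ring

/-- **Cameron-Martin formula** for the standard Gaussian measure. -/
lemma integral_stdGaussian_eq_integral_add (F : E → ℝ) (s : E) :
    ∫ z, F z ∂(stdGaussian E) =
      ∫ z, Real.exp (-inner ℝ s z - ‖s‖ ^ 2 / 2) * F (z + s) ∂(stdGaussian E) := by
  obtain ⟨c, hc, h⟩ := stdGaussian_eq_withDensity (E := E)
  have hmeas : Measurable (fun v : E => ENNReal.ofReal (c * Real.exp (-(1 / 2) * ‖v‖ ^ 2))) := by
    fun_prop
  rw [h, integral_withDensity_eq_integral_toReal_smul hmeas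
      (ae_of_all _ fun _ => ENNReal.ofReal_lt_top),
    integral_withDensity_eq_integral_toReal_smul hmeas
      (ae_of_all _ fun _ => ENNReal.ofReal_lt_top), ← integral_add_right_eq_self _ s]
  refine integral_congr_ae (ae_of_all _ fun z => ?_)
  simp only [smul_eq_mul]
  have hexp : Real.exp (-(1 / 2) * ‖z + s‖ ^ 2) =
      Real.exp (-(1 / 2) * ‖z‖ ^ 2) * Real.exp (-inner ℝ s z - ‖s‖ ^ 2 / 2) := by
    rw [← Real.exp_add, norm_add_sq_real, real_inner_comm]
    congr 1
    ring
  rw [ENNReal.toReal_ofReal (by positivity), ENNReal.toReal_ofReal (by positivity), hexp]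
  ring

lemma integrable_of_bounded {X : Type*} [MeasurableSpace X] {μ : Measure X} [IsFiniteMeasure μ]
    {f : X → ℝ} (hf : Measurable f) {B : ℝ} (hB : ∀ x, |f x| ≤ B) : Integrable f μ :=
  Integrable.of_bound hf.aestronglyMeasurable B (ae_of_all _ hB)

/-- Entropy inequality for a translate of the standard Gaussian measure. -/
lemma integral_add_le_log_integral_exp {g : E → ℝ} (hg : Measurable g) {B : ℝ}
    (hB : ∀ z, |g z| ≤ B) (s : E) :
    ∫ z, g (z + s) ∂(stdGaussian E) ≤
      Real.log (∫ z, Real.exp (g z) ∂(stdGaussian E)) + ‖s‖ ^ 2 / 2 := by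
  have hint1 : Integrable (fun z => g (z + s)) (stdGaussian E) :=
    integrable_of_bounded (by fun_prop) (fun z => hB _)
  have hid : Integrable (fun z : E => z) (stdGaussian E) := IsGaussian.integrable_id
  have hint2 : Integrable (fun z : E => inner ℝ s z) (stdGaussian E) :=
    hid.const_inner s
  have hzero : ∫ z : E, inner ℝ s z ∂(stdGaussian E) = 0 := by
    rw [integral_inner hid s]; simp
  have hint12 : Integrable (fun z => g (z + s) - inner ℝ s z) (stdGaussian E) := hint1.sub hint2
  have hint3 : Integrable (fun z => g (z + s) - inner ℝ s z - ‖s‖ ^ 2 / 2) (stdGaussian E) :=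
    hint12.sub (integrable_const _)
  have heq : ∫ z, Real.exp (g z) ∂(stdGaussian E) =
      ∫ z, Real.exp (g (z + s) - inner ℝ s z - ‖s‖ ^ 2 / 2) ∂(stdGaussian E) := by
    rw [integral_stdGaussian_eq_integral_add _ s]
    refine integral_congr_ae (ae_of_all _ fun z => ?_)
    simp only
    rw [← Real.exp_add]
    congr 1
    ring
  have hexpint : Integrable (fun z => Real.exp (g (z + s) - inner ℝ s z - ‖s‖ ^ 2 / 2))
      (stdGaussian E) := by
    -- If the exponential were not integrable its integral would be `0` by convention, contradicting
    -- `heq`, whose left side is positive.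
    by_contra hn
    have h0 := integral_undef hn
    rw [← heq] at h0
    have : 0 < ∫ z, Real.exp (g z) ∂(stdGaussian E) := by
      refine integral_exp_pos (integrable_of_bounded (by fun_prop) (B := Real.exp B) fun z => ?_)
      rw [abs_of_pos (Real.exp_pos _)]
      exact Real.exp_le_exp.2 ((le_abs_self _).trans (hB z))
    exact this.ne' h0
  -- Jensen's inequality for the Cameron-Martin exponent; its linear term has mean zero.
  have hJ := convexOn_exp.map_integral_le (μ := stdGaussian E) Real.continuous_exp.continuousOn
    isClosed_univ (ae_of_all _ fun _ => mem_univ _) hint3 hexpint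
  rw [← heq] at hJ
  have hlog := (Real.le_log_iff_exp_le ((Real.exp_pos _).trans_le hJ)).2 hJ
  rw [integral_sub hint12 (integrable_const _), integral_sub hint1 hint2, hzero] at hlog
  simp at hlog
  linarith

lemma integral_add_smul_le_log {g : E → ℝ} (hg : Measurable g) {B : ℝ}
    (hB : ∀ z, |g z| ≤ B) {σ : ℝ} (hσ : σ ≠ 0) (a b : E) :
    ∫ z, g (a + σ • z) ∂(stdGaussian E) ≤
      Real.log (∫ z, Real.exp (g (b + σ • z)) ∂(stdGaussian E)) + ‖a - b‖ ^ 2 / (2 * σ ^ 2) := by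
  have h := integral_add_le_log_integral_exp (g := fun z => g (b + σ • z)) (by fun_prop)
    (fun z => hB _) (σ⁻¹ • (a - b))
  have h1 : ∀ z, b + σ • (z + σ⁻¹ • (a - b)) = a + σ • z := by
    intro z
    rw [smul_add, smul_inv_smul₀ hσ]
    abel
  simp_rw [h1] at h
  refine h.trans_eq ?_
  rw [norm_smul, mul_pow, norm_inv, inv_pow, Real.norm_eq_abs, sq_abs]
  congr 1
  field_simp

end Gaussian

end GaussianChain

namespace GaussianChain

/-! ### Bounded measurable functions -/

section BddMeas

variable {X : Type*} [MeasurableSpace X]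

/-- Bounded measurable real functions. -/
def IsBddMeas (φ : X → ℝ) : Prop := Measurable φ ∧ ∃ B, ∀ x, |φ x| ≤ B

variable {φ ψ : X → ℝ}

lemma IsBddMeas.of_mem_Icc (hφ : Measurable φ) {a b : ℝ} (h : ∀ x, φ x ∈ Icc a b) :
    IsBddMeas φ := by
  refine ⟨hφ, max |a| |b|, fun x => ?_⟩
  exact abs_le_max_abs_abs (h x).1 (h x).2

lemma IsBddMeas.add (hφ : IsBddMeas φ) (hψ : IsBddMeas ψ) : IsBddMeas (fun x => φ x + ψ x) := by
  obtain ⟨B, hB⟩ := hφ.2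
  obtain ⟨C, hC⟩ := hψ.2
  exact ⟨hφ.1.add hψ.1, B + C, fun x => (abs_add_le _ _).trans (add_le_add (hB x) (hC x))⟩

lemma IsBddMeas.const_mul (hφ : IsBddMeas φ) (c : ℝ) : IsBddMeas (fun x => c * φ x) := by
  obtain ⟨B, hB⟩ := hφ.2
  refine ⟨hφ.1.const_mul c, |c| * B, fun x => ?_⟩
  rw [abs_mul]
  exact mul_le_mul_of_nonneg_left (hB x) (abs_nonneg c)

lemma isBddMeas_const (c : ℝ) : IsBddMeas (fun _ : X => c) :=
  ⟨measurable_const, |c|, fun _ => le_rfl⟩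

lemma IsBddMeas.exp (hφ : IsBddMeas φ) : IsBddMeas (fun x => Real.exp (φ x)) := by
  obtain ⟨B, hB⟩ := hφ.2
  refine ⟨hφ.1.exp, Real.exp B, fun x => ?_⟩
  rw [abs_of_pos (Real.exp_pos _)]
  exact Real.exp_le_exp.2 ((le_abs_self _).trans (hB x))

lemma IsBddMeas.integrable (hφ : IsBddMeas φ) {μ : Measure X} [IsFiniteMeasure μ] :
    Integrable φ μ :=
  integrable_of_bounded hφ.1 hφ.2.choose_spec

end BddMeas

/-! ### The transition operator and the log-Harnack inequality -/

section Step

variable {E : Type*} [NormedAddCommGroup E] [InnerProductSpace ℝ E] [FiniteDimensional ℝ E]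
  [MeasurableSpace E]

/-- The transition operator of the chain `x ↦ T x + σ z` with standard Gaussian noise `z`. -/
noncomputable def step (T : E → E) (σ : ℝ) (φ : E → ℝ) (x : E) : ℝ :=
  ∫ z, φ (T x + σ • z) ∂(stdGaussian E)

variable {T : E → E} {σ : ℝ} {φ ψ : E → ℝ}

lemma step_const_mul (c : ℝ) : step T σ (fun x => c * φ x) = fun x => c * step T σ φ x := by
  funext x
  exact integral_const_mul _ _

lemma iterate_const_mul (c : ℝ) (k : ℕ) :
    (step T σ)^[k] (fun x => c * φ x) = fun x => c * (step T σ)^[k] φ x := by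
  induction k with
  | zero => rfl
  | succ k ih =>
    simp only [Function.iterate_succ_apply']
    rw [ih, step_const_mul]

variable [BorelSpace E]

lemma IsBddMeas.integrable_comp (hφ : IsBddMeas φ) (a : E) (σ : ℝ) :
    Integrable (fun z => φ (a + σ • z)) (stdGaussian E) :=
  integrable_of_bounded (hφ.1.comp (by fun_prop)) fun z => hφ.2.choose_spec (a + σ • z)

lemma step_mem_Icc {a b : ℝ} (hφ : Measurable φ) (h : ∀ x, φ x ∈ Icc a b) (x : E) :
    step T σ φ x ∈ Icc a b := by
  have hi := (IsBddMeas.of_mem_Icc hφ h).integrable_comp (T x) σ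
  constructor
  · simpa [step] using integral_mono (integrable_const a) hi fun z => (h (T x + σ • z)).1
  · simpa [step] using integral_mono hi (integrable_const b) fun z => (h (T x + σ • z)).2

lemma measurable_step (hT : Measurable T) (hφ : Measurable φ) : Measurable (step T σ φ) := by
  have : Measurable (fun p : E × E => φ (T p.1 + σ • p.2)) := hφ.comp (by fun_prop)
  exact (this.stronglyMeasurable.integral_prod_right (ν := stdGaussian E)).measurable

lemma IsBddMeas.step (hφ : IsBddMeas φ) (hT : Measurable T) : IsBddMeas (step T σ φ) := by
  obtain ⟨B, hB⟩ := hφ.2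
  exact .of_mem_Icc (measurable_step hT hφ.1) fun x =>
    step_mem_Icc hφ.1 (fun y => abs_le.1 (hB y)) x

lemma step_add (hφ : IsBddMeas φ) (hψ : IsBddMeas ψ) :
    step T σ (fun x => φ x + ψ x) = fun x => step T σ φ x + step T σ ψ x := by
  funext x
  exact integral_add (hφ.integrable_comp _ _) (hψ.integrable_comp _ _)

lemma step_const (c : ℝ) : step T σ (fun _ => c) = fun _ => c := by
  funext x
  simp [step]

lemma step_mono (hφ : IsBddMeas φ) (hψ : IsBddMeas ψ) (h : ∀ x, φ x ≤ ψ x) (x : E) :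
    step T σ φ x ≤ step T σ ψ x :=
  integral_mono (hφ.integrable_comp _ _) (hψ.integrable_comp _ _) fun _ => h _

lemma IsBddMeas.iterate (hφ : IsBddMeas φ) (hT : Measurable T) (k : ℕ) :
    IsBddMeas ((GaussianChain.step T σ)^[k] φ) := by
  induction k with
  | zero => exact hφ
  | succ k ih => rw [Function.iterate_succ_apply']; exact ih.step hT

lemma iterate_mem_Icc (hT : Measurable T) {a b : ℝ} (hφ : Measurable φ)
    (h : ∀ x, φ x ∈ Icc a b) (k : ℕ) : ∀ x, (step T σ)^[k] φ x ∈ Icc a b := by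
  induction k with
  | zero => exact h
  | succ k ih =>
    rw [Function.iterate_succ_apply']
    exact step_mem_Icc (((IsBddMeas.of_mem_Icc hφ h).iterate hT k).1) ih

lemma iterate_add (hT : Measurable T) (hφ : IsBddMeas φ) (hψ : IsBddMeas ψ) (k : ℕ) :
    (step T σ)^[k] (fun x => φ x + ψ x) =
      fun x => (step T σ)^[k] φ x + (step T σ)^[k] ψ x := by
  induction k with
  | zero => rfl
  | succ k ih =>
    simp only [Function.iterate_succ_apply']
    rw [ih, step_add (hφ.iterate hT k) (hψ.iterate hT k)]

lemma iterate_const (c : ℝ) (k : ℕ) : (step T σ)^[k] (fun _ => c) = fun _ => c := by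
  induction k with
  | zero => rfl
  | succ k ih => rw [Function.iterate_succ_apply', ih, step_const]

lemma iterate_mono (hT : Measurable T) (hφ : IsBddMeas φ) (hψ : IsBddMeas ψ)
    (h : ∀ x, φ x ≤ ψ x) (k : ℕ) : ∀ x, (step T σ)^[k] φ x ≤ (step T σ)^[k] ψ x := by
  induction k with
  | zero => exact h
  | succ k ih =>
    simp only [Function.iterate_succ_apply']
    exact step_mono (hφ.iterate hT k) (hψ.iterate hT k) ih

/-- Synchronous coupling: an affine modulus of continuity is propagated by the chain. -/
lemma abs_step_sub_le (hφ : IsBddMeas φ) {a c : ℝ}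
    (h : ∀ x y, |φ x - φ y| ≤ a * ‖x - y‖ + c) (x y : E) :
    |step T σ φ x - step T σ φ y| ≤ a * ‖T x - T y‖ + c := by
  rw [step, step, ← integral_sub (hφ.integrable_comp _ _) (hφ.integrable_comp _ _)]
  have := norm_integral_le_of_norm_le_const (μ := stdGaussian E)
    (f := fun z => φ (T x + σ • z) - φ (T y + σ • z)) (C := a * ‖T x - T y‖ + c)
    (ae_of_all _ fun z => by
      have := h (T x + σ • z) (T y + σ • z)
      rwa [add_sub_add_right_eq_sub] at this)
  simpa using this

/-- **Log-Harnack inequality** for the chain. -/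
lemma log_harnack (hT : Measurable T) (hσ : σ ≠ 0) {Λ : ℝ} (hΛ : 1 ≤ Λ)
    (hlip : ∀ x y, ‖T x - T y‖ ≤ Λ * ‖x - y‖) (hφ : IsBddMeas φ) (k : ℕ) : ∀ a b : E,
    step id σ ((step T σ)^[k] φ) a ≤
      Real.log (step id σ ((step T σ)^[k] (fun x => Real.exp (φ x))) b) +
        Λ ^ (2 * k) / (2 * (k + 1) * σ ^ 2) * ‖a - b‖ ^ 2 := by
  have hσ2 : 0 < σ ^ 2 := by positivity
  obtain ⟨B, hB⟩ := hφ.2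
  induction k with
  | zero =>
    intro a b
    have := integral_add_smul_le_log hφ.1 hB hσ a b
    simp only [step, id, Function.iterate_zero]
    refine this.trans_eq ?_
    simp
    ring
  | succ k ih =>
    intro a b
    set g := (step T σ)^[k + 1] φ with hg
    set e := (step T σ)^[k + 1] (fun x => Real.exp (φ x)) with he
    have hebd : ∀ x, e x ∈ Icc (Real.exp (-B)) (Real.exp B) :=
      iterate_mem_Icc hT hφ.1.exp (fun x => ⟨Real.exp_le_exp.2 (abs_le.1 (hB x)).1,
        Real.exp_le_exp.2 (abs_le.1 (hB x)).2⟩) _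
    have hepos : ∀ x, 0 < e x := fun x => (Real.exp_pos _).trans_le (hebd x).1
    have hemeas : Measurable e := (hφ.exp.iterate hT _).1
    have hgmeas : IsBddMeas g := hφ.iterate hT _
    have hG : ∀ x, |Real.log (e x)| ≤ B := by
      intro x
      rw [abs_le]
      exact ⟨(Real.le_log_iff_exp_le (hepos x)).2 (hebd x).1,
        (Real.log_le_iff_le_exp (hepos x)).2 (hebd x).2⟩
    have hGmeas : IsBddMeas (fun x => Real.log (e x)) := ⟨hemeas.log, B, hG⟩
    -- By definition `step T σ ψ x` is `step id σ ψ (T x)`, so the induction hypothesis at `T x`, `T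
    -- y` is a pointwise bound after one more step.
    have hone : ∀ x y, g x ≤ Real.log (e y) +
        Λ ^ (2 * (k + 1)) / (2 * (k + 1) * σ ^ 2) * ‖x - y‖ ^ 2 := by
      intro x y
      have h1 := ih (T x) (T y)
      have h2 : ‖T x - T y‖ ^ 2 ≤ Λ ^ 2 * ‖x - y‖ ^ 2 := by
        rw [← mul_pow]
        exact pow_le_pow_left₀ (norm_nonneg _) (hlip x y) 2
      rw [hg, he, Function.iterate_succ_apply', Function.iterate_succ_apply']
      refine h1.trans (add_le_add le_rfl ?_)
      calc _ ≤ Λ ^ (2 * k) / (2 * (k + 1) * σ ^ 2) * (Λ ^ 2 * ‖x - y‖ ^ 2) :=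
            mul_le_mul_of_nonneg_left h2 (by positivity)
        _ = _ := by ring
    -- The displacement is shared: a fraction `θ` is paid by the entropy of the first noise, the
    -- rest by `hone` under a common noise. For `Λ = 1` this `θ` minimises the total `θ² + (1 - θ)²
    -- / (k + 1)`, with minimum `1 / (k + 2)`.
    set θ : ℝ := 1 / (k + 2) with hθ
    set c : ℝ := Λ ^ (2 * (k + 1)) / (2 * (k + 1) * σ ^ 2) with hc
    have hstep : step id σ g a ≤
        step id σ (fun x => Real.log (e x)) (b + θ • (a - b)) + c * ((1 - θ) ^ 2 * ‖a - b‖ ^ 2) := by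
      have : step id σ (fun x => Real.log (e x)) (b + θ • (a - b)) + c * ((1 - θ) ^ 2 * ‖a - b‖ ^ 2)
          = ∫ z, (Real.log (e (b + θ • (a - b) + σ • z)) + c * ((1 - θ) ^ 2 * ‖a - b‖ ^ 2))
            ∂(stdGaussian E) := by
        rw [integral_add (hGmeas.integrable_comp _ _) (integrable_const _)]
        simp [step]
      rw [this]
      refine integral_mono (hgmeas.integrable_comp _ _)
        ((hGmeas.integrable_comp _ _).add (integrable_const _)) fun z => ?_
      refine (hone _ (b + θ • (a - b) + σ • z)).trans_eq ?_
      have : id a + σ • z - (b + θ • (a - b) + σ • z) = (1 - θ) • (a - b) := by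
        simp only [id]; module
      rw [this, norm_smul, mul_pow, Real.norm_eq_abs, sq_abs]
    have hent := integral_add_smul_le_log hGmeas.1 hG hσ (b + θ • (a - b)) b
    simp_rw [Real.exp_log (hepos _)] at hent
    rw [add_sub_cancel_left, norm_smul, mul_pow, Real.norm_eq_abs, sq_abs] at hent
    have hcoef : θ ^ 2 / (2 * σ ^ 2) + c * (1 - θ) ^ 2 ≤
        Λ ^ (2 * (k + 1)) / (2 * ((k + 1 : ℕ) + 1) * σ ^ 2) := by
      have hΛ' : 1 ≤ Λ ^ (2 * (k + 1)) := one_le_pow₀ hΛ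
      have h1 : θ ^ 2 / (2 * σ ^ 2) ≤ Λ ^ (2 * (k + 1)) * (θ ^ 2 / (2 * σ ^ 2)) :=
        le_mul_of_one_le_left (by positivity) hΛ'
      refine (add_le_add_left h1 _).trans_eq ?_
      rw [hc, hθ]
      push_cast
      field_simp
      ring
    calc step id σ g a ≤ _ := hstep
      _ ≤ (Real.log (step id σ e b) + θ ^ 2 * ‖a - b‖ ^ 2 / (2 * σ ^ 2)) +
          c * ((1 - θ) ^ 2 * ‖a - b‖ ^ 2) := add_le_add_left hent _
      _ = Real.log (step id σ e b) +
          (θ ^ 2 / (2 * σ ^ 2) + c * (1 - θ) ^ 2) * ‖a - b‖ ^ 2 := by ring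
      _ ≤ _ := add_le_add le_rfl (mul_le_mul_of_nonneg_right hcoef (by positivity))

end Step

end GaussianChain

namespace GaussianChain

/-! ### Regularisation and overlap from the log-Harnack inequality -/

section Smoothing

variable {E : Type*} [NormedAddCommGroup E] [InnerProductSpace ℝ E] [FiniteDimensional ℝ E]
  [MeasurableSpace E] [BorelSpace E] {T : E → E} {σ Λ : ℝ} {f : E → ℝ}

lemma smooth_le_affine (hT : Measurable T) {φ : E → ℝ} (hφ : IsBddMeas φ) (hf : IsBddMeas f)
    {α β : ℝ} (h : ∀ x, φ x ≤ α + β * f x) (k : ℕ) (b : E) :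
    step id σ ((step T σ)^[k] φ) b ≤ α + β * step id σ ((step T σ)^[k] f) b := by
  have h1 := step_mono (σ := σ) (hφ.iterate (σ := σ) hT k)
    (((isBddMeas_const α).add (hf.const_mul β)).iterate (σ := σ) hT k)
    (iterate_mono hT hφ ((isBddMeas_const α).add (hf.const_mul β)) h k) (T := id) b
  rwa [iterate_add hT (isBddMeas_const α) (hf.const_mul β), iterate_const, iterate_const_mul,
    step_add (isBddMeas_const α) ((hf.iterate hT k).const_mul β), step_const, step_const_mul] at h1

lemma smooth_mem_Icc (hT : Measurable T) (hf : Measurable f) (hf01 : ∀ x, f x ∈ Icc (0 : ℝ) 1)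
    (k : ℕ) (a : E) : step id σ ((step T σ)^[k] f) a ∈ Icc (0 : ℝ) 1 :=
  step_mem_Icc ((IsBddMeas.of_mem_Icc hf hf01).iterate hT k).1 (iterate_mem_Icc hT hf hf01 k) a

lemma smooth_exp_pos (hT : Measurable T) (hf : Measurable f) (hf01 : ∀ x, f x ∈ Icc (0 : ℝ) 1)
    {t : ℝ} (ht : 0 ≤ t) (k : ℕ) (b : E) :
    0 < step id σ ((step T σ)^[k] (fun x => Real.exp (t * f x))) b := by
  have h01 : ∀ x, Real.exp (t * f x) ∈ Icc 1 (Real.exp t) := fun x =>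
    ⟨Real.one_le_exp (mul_nonneg ht (hf01 x).1),
      Real.exp_le_exp.2 (mul_le_of_le_one_right ht (hf01 x).2)⟩
  have hm : Measurable fun x => Real.exp (t * f x) := (hf.const_mul t).exp
  exact zero_lt_one.trans_le (step_mem_Icc ((IsBddMeas.of_mem_Icc hm h01).iterate hT k).1
    (iterate_mem_Icc hT hm h01 k) b).1

/-- The log-Harnack inequality for `t * f` has error `t²` when `t = √c * ‖a - b‖`. For `t < 1`, `exp
u ≤ 1 + u + u²` and `log x ≤ x - 1` cost another `t²`, and dividing by `t` leaves `2 t`. For `t ≥ 1`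
the range `[0, 1]` suffices. -/
lemma smooth_sub_le (hT : Measurable T) (hσ : σ ≠ 0) (hΛ : 1 ≤ Λ)
    (hlip : ∀ x y, ‖T x - T y‖ ≤ Λ * ‖x - y‖) (hf : Measurable f)
    (hf01 : ∀ x, f x ∈ Icc (0 : ℝ) 1) (k : ℕ) (a b : E) :
    step id σ ((step T σ)^[k] f) a - step id σ ((step T σ)^[k] f) b ≤
      2 * (√(Λ ^ (2 * k) / (2 * (k + 1) * σ ^ 2)) * ‖a - b‖) := by
  have hσ2 : 0 < σ ^ 2 := by positivity
  have hfb := IsBddMeas.of_mem_Icc hf hf01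
  set c : ℝ := Λ ^ (2 * k) / (2 * (k + 1) * σ ^ 2) with hc
  have hcpos : 0 < c := by positivity
  set t := √c * ‖a - b‖ with ht
  have hC : c * ‖a - b‖ ^ 2 = t ^ 2 := by rw [ht, mul_pow, Real.sq_sqrt hcpos.le]
  have ha := smooth_mem_Icc (σ := σ) hT hf hf01 k a
  have hb := smooth_mem_Icc (σ := σ) hT hf hf01 k b
  by_cases hab : ‖a - b‖ = 0
  · rw [norm_eq_zero, sub_eq_zero] at hab
    subst hab
    simp only [sub_self]
    positivity
  have htpos : 0 < t := by
    have : 0 < ‖a - b‖ := lt_of_le_of_ne (norm_nonneg _) (Ne.symm hab)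
    positivity
  rcases le_or_gt 1 t with h1 | h1
  · linarith [ha.2, hb.1]
  have hLH := log_harnack hT hσ hΛ hlip (hfb.const_mul t) k a b
  rw [iterate_const_mul, step_const_mul, hC] at hLH
  have hpt : ∀ x, Real.exp (t * f x) ≤ (1 + t ^ 2) + t * f x := by
    intro x
    have h0 : 0 ≤ t * f x := mul_nonneg htpos.le (hf01 x).1
    have hle : t * f x ≤ t := mul_le_of_le_one_right htpos.le (hf01 x).2
    have h2 := Real.abs_exp_sub_one_sub_id_le (x := t * f x) (by rw [abs_of_nonneg h0]; linarith)
    have h3 := (abs_le.1 h2).2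
    have h4 : (t * f x) ^ 2 ≤ t ^ 2 := pow_le_pow_left₀ h0 hle 2
    linarith
  have hup := smooth_le_affine (σ := σ) hT (hfb.const_mul t).exp hfb hpt k b
  have hlog := Real.log_le_sub_one_of_pos (smooth_exp_pos (σ := σ) hT hf hf01 htpos.le k b)
  have hfin : t * (step id σ ((step T σ)^[k] f) a - step id σ ((step T σ)^[k] f) b) ≤
      t * (2 * t) := by
    simp only at hLH
    linarith
  exact le_of_mul_le_mul_left hfin htpos

/-- Regularisation: the chain maps functions with values in `[0, 1]` to Lipschitz functions. -/
lemma abs_smooth_sub_le (hT : Measurable T) (hσ : σ ≠ 0) (hΛ : 1 ≤ Λ)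
    (hlip : ∀ x y, ‖T x - T y‖ ≤ Λ * ‖x - y‖) (hf : Measurable f)
    (hf01 : ∀ x, f x ∈ Icc (0 : ℝ) 1) (k : ℕ) (a b : E) :
    |step id σ ((step T σ)^[k] f) a - step id σ ((step T σ)^[k] f) b| ≤
      2 * √(Λ ^ (2 * k) / (2 * (k + 1) * σ ^ 2)) * ‖a - b‖ := by
  rw [mul_assoc]
  have h1 := smooth_sub_le hT hσ hΛ hlip hf hf01 k a b
  have h2 := smooth_sub_le hT hσ hΛ hlip hf hf01 k b a
  rw [norm_sub_rev b a] at h2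
  exact abs_le.2 ⟨by linarith, h1⟩

/-- Overlap of the laws started at two points: the bound is smaller than `1`, and only depends on
an upper bound for the Harnack exponent. -/
lemma smooth_sub_le_one_sub (hT : Measurable T) (hσ : σ ≠ 0) (hΛ : 1 ≤ Λ)
    (hlip : ∀ x y, ‖T x - T y‖ ≤ Λ * ‖x - y‖) (hf : Measurable f)
    (hf01 : ∀ x, f x ∈ Icc (0 : ℝ) 1) (k : ℕ) (a b : E) {C : ℝ}
    (hC : Λ ^ (2 * k) / (2 * (k + 1) * σ ^ 2) * ‖a - b‖ ^ 2 ≤ C) :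
    step id σ ((step T σ)^[k] f) a - step id σ ((step T σ)^[k] f) b ≤
      1 - min (1 / 2) (Real.exp (-(2 * (Real.log 2 + C)))) := by
  have hσ2 : 0 < σ ^ 2 := by positivity
  have hfb := IsBddMeas.of_mem_Icc hf hf01
  have hC0 : 0 ≤ C := le_trans (by positivity) hC
  -- If the mean at `b` is below `exp (-t)`, the exponential moment of `t * f` at `b` is at most
  -- `2`, so Harnack bounds `t` times the mean at `a` by `log 2 + C = t / 2`.
  set t := 2 * (Real.log 2 + C) with ht
  have hlog2 : 0 < Real.log 2 := Real.log_pos (by norm_num)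
  have htpos : 0 < t := by positivity
  have ha := smooth_mem_Icc (σ := σ) hT hf hf01 k a
  have hb := smooth_mem_Icc (σ := σ) hT hf hf01 k b
  set u := step id σ ((step T σ)^[k] f) a
  set v := step id σ ((step T σ)^[k] f) b
  rcases le_or_gt (Real.exp (-t)) v with hv | hv
  · linarith [ha.2, min_le_right (1 / 2) (Real.exp (-t))]
  have hLH := log_harnack hT hσ hΛ hlip (hfb.const_mul t) k a b
  rw [iterate_const_mul, step_const_mul] at hLH
  have hpt : ∀ x, Real.exp (t * f x) ≤ 1 + (Real.exp t - 1) * f x := by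
    intro x
    have := convexOn_exp.2 (mem_univ 0) (mem_univ t) (sub_nonneg.2 (hf01 x).2) (hf01 x).1
      (by ring)
    simp only [smul_eq_mul, mul_zero, zero_add, Real.exp_zero, mul_one] at this
    rw [mul_comm t]
    linarith
  have hup := smooth_le_affine (σ := σ) hT (hfb.const_mul t).exp hfb hpt k b
  have hle2 : step id σ ((step T σ)^[k] (fun x => Real.exp (t * f x))) b ≤ 2 := by
    have h1 : (Real.exp t - 1) * v ≤ Real.exp t * Real.exp (-t) := by
      refine mul_le_mul (by linarith) hv.le hb.1 (Real.exp_pos _).le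
    rw [← Real.exp_add, add_neg_cancel, Real.exp_zero] at h1
    linarith
  have hlog := Real.log_le_log (smooth_exp_pos (σ := σ) hT hf hf01 htpos.le k b) hle2
  have hu : t * u ≤ t * (1 / 2) := by
    simp only at hLH
    have : t * (1 / 2) = Real.log 2 + C := by rw [ht]; ring
    linarith
  have hu' := le_of_mul_le_mul_left hu htpos
  linarith [hb.1, min_le_left (1 / 2) (Real.exp (-t))]

end Smoothing

/-! ### Harris-type contraction -/

section Contraction

/-- The functions whose oscillation is controlled by the distance `1 + β ‖x - y‖`. -/
def OscClass {E : Type*} [NormedAddCommGroup E] (β : ℝ) (φ : E → ℝ) : Prop :=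
  ∀ x y, |φ x - φ y| ≤ 1 + β * ‖x - y‖

/-- A function with oscillation at most `1 + β ‖x - y‖` is the sum of a `β`-Lipschitz function
and a function with values in `[0, 1]`. -/
lemma OscClass.exists_lipschitz {E : Type*} [NormedAddCommGroup E] {β : ℝ} (hβ : 0 ≤ β)
    {φ : E → ℝ} (hφ : OscClass β φ) :
    ∃ g : E → ℝ, (∀ x y, |g x - g y| ≤ β * ‖x - y‖) ∧ ∀ x, φ x - g x ∈ Icc (0 : ℝ) 1 := by
  have hlow : ∀ x y, φ x - 1 ≤ φ y + β * ‖x - y‖ := fun x y => by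
    linarith [(abs_le.1 (hφ x y)).2]
  have hbdd : ∀ x, BddBelow (range fun y => φ y + β * ‖x - y‖) := fun x =>
    ⟨φ x - 1, by rintro _ ⟨y, rfl⟩; exact hlow x y⟩
  -- The infimal convolution with `β‖·‖` is `β`-Lipschitz and at most `φ`; the oscillation bound
  -- keeps it above `φ - 1`.
  set g : E → ℝ := fun x => ⨅ y, φ y + β * ‖x - y‖ with hg
  have hone : ∀ x y, g x ≤ g y + β * ‖x - y‖ := by
    intro x y
    rw [← sub_le_iff_le_add]
    refine le_ciInf fun w => ?_
    rw [sub_le_iff_le_add]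
    refine (ciInf_le (hbdd x) w).trans ?_
    have := mul_le_mul_of_nonneg_left (norm_sub_le_norm_sub_add_norm_sub x y w) hβ
    linarith
  refine ⟨g, fun x y => ?_, fun x => ⟨?_, ?_⟩⟩
  · have h1 := hone x y
    have h2 := hone y x
    rw [norm_sub_rev y x] at h2
    exact abs_le.2 ⟨by linarith, by linarith⟩
  · have := ciInf_le (hbdd x) x
    simp only [sub_self, norm_zero, mul_zero, add_zero] at this
    linarith
  · have : φ x - 1 ≤ g x := le_ciInf fun y => hlow x y
    linarith

lemma measurable_of_abs_sub_le {E : Type*} [NormedAddCommGroup E] [MeasurableSpace E]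
    [BorelSpace E] {g : E → ℝ} {β : ℝ} (hg : ∀ x y, |g x - g y| ≤ β * ‖x - y‖) :
    Measurable g := by
  refine (LipschitzWith.of_dist_le_mul (K := β.toNNReal) fun x y => ?_).continuous.measurable
  rw [Real.dist_eq, dist_eq_norm]
  exact (hg x y).trans (mul_le_mul_of_nonneg_right (Real.le_coe_toNNReal β) (norm_nonneg _))

lemma OscClass.exists_decomposition {E : Type*} [NormedAddCommGroup E] [MeasurableSpace E]
    [BorelSpace E] {φ : E → ℝ} {β : ℝ} (hβ : 0 ≤ β) (hφ : OscClass β φ)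
    (hφb : IsBddMeas φ) :
    ∃ g f : E → ℝ, IsBddMeas g ∧ (∀ x y, |g x - g y| ≤ β * ‖x - y‖) ∧ Measurable f ∧
      (∀ x, f x ∈ Icc (0 : ℝ) 1) ∧ φ = fun x => g x + f x := by
  obtain ⟨g, hg, hf⟩ := hφ.exists_lipschitz hβ
  have hgm := measurable_of_abs_sub_le hg
  have hfm : Measurable fun x => φ x - g x := hφb.1.sub hgm
  refine ⟨g, fun x => φ x - g x, ?_, hg, hfm, hf, by funext x; ring⟩
  have := hφb.add ((IsBddMeas.of_mem_Icc hfm hf).const_mul (-1))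
  simpa using this

variable {E : Type*} [NormedAddCommGroup E] [InnerProductSpace ℝ E] [FiniteDimensional ℝ E]
  [MeasurableSpace E] [BorelSpace E] {T : E → E} {σ Λ : ℝ} {φ : E → ℝ}

lemma abs_iterate_sub_le_pow (hT : Measurable T) (hΛ : 0 ≤ Λ)
    (hlip : ∀ x y, ‖T x - T y‖ ≤ Λ * ‖x - y‖) (hφ : IsBddMeas φ) {β : ℝ} (hβ : 0 ≤ β)
    (h : ∀ x y, |φ x - φ y| ≤ β * ‖x - y‖) (k : ℕ) :
    ∀ x y, |(step T σ)^[k] φ x - (step T σ)^[k] φ y| ≤ β * Λ ^ k * ‖x - y‖ := by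
  induction k with
  | zero => simpa using h
  | succ k ih =>
    intro x y
    rw [Function.iterate_succ_apply']
    have h1 := abs_step_sub_le (T := T) (σ := σ) (hφ.iterate hT k) (a := β * Λ ^ k) (c := 0)
      (by simpa using ih) x y
    rw [add_zero] at h1
    refine h1.trans ((mul_le_mul_of_nonneg_left (hlip x y) (by positivity)).trans_eq ?_)
    ring

/-- The additive errors `(1 - q) * R` accumulate as a geometric series with total `(1 - q ^ k) * R`,
hence stay below `R` for every `k`. -/
lemma abs_iterate_sub_le_add (hT : Measurable T) {q R : ℝ} (hq : 0 ≤ q) (hR : 0 ≤ R)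
    (hcontr : ∀ x y, ‖T x - T y‖ ≤ q * ‖x - y‖ + (1 - q) * R) (hφ : IsBddMeas φ)
    {β : ℝ} (hβ : 0 ≤ β) (h : ∀ x y, |φ x - φ y| ≤ β * ‖x - y‖) (k : ℕ) (x y : E) :
    |(step T σ)^[k] φ x - (step T σ)^[k] φ y| ≤ β * (q ^ k * ‖x - y‖ + R) := by
  have key : ∀ x y, |(step T σ)^[k] φ x - (step T σ)^[k] φ y| ≤
      β * q ^ k * ‖x - y‖ + β * (1 - q ^ k) * R := by
    induction k with
    | zero => simpa using h
    | succ k ih =>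
      intro x y
      rw [Function.iterate_succ_apply']
      refine (abs_step_sub_le (hφ.iterate hT k) ih x y).trans ?_
      have := mul_le_mul_of_nonneg_left (hcontr x y) (show 0 ≤ β * q ^ k by positivity)
      rw [pow_succ]
      linarith
  refine (key x y).trans ?_
  have : 0 ≤ β * q ^ k * R := by positivity
  linarith

/-- **Harris-type contraction** in the seminorm dual to `1 + β ‖x - y‖`. -/
lemma OscClass.abs_iterate_sub_le (hT : Measurable T) {q R α β : ℝ} (hq : 0 ≤ q) (hR : 0 ≤ R)
    (hcontr : ∀ x y, ‖T x - T y‖ ≤ q * ‖x - y‖ + (1 - q) * R) {N : ℕ} (hqN : q ^ N ≤ 1 / 2)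
    (hα0 : 0 ≤ α) (hα1 : α < 1)
    (hα : ∀ f : E → ℝ, Measurable f → (∀ x, f x ∈ Icc (0 : ℝ) 1) → ∀ x y,
      ‖x - y‖ ≤ 4 * (R + 1) → (step T σ)^[N] f x - (step T σ)^[N] f y ≤ α)
    (hβ : β = (1 - α) / (2 * (R + 1))) (hφ : OscClass β φ) (hφb : IsBddMeas φ) (x y : E) :
    |(step T σ)^[N] φ x - (step T σ)^[N] φ y| ≤ (1 - β / 2) * (1 + β * ‖x - y‖) := by
  have hβpos : 0 < β := by rw [hβ]; exact div_pos (by linarith) (by linarith)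
  have hβR : β * (R + 1) = (1 - α) / 2 := by rw [hβ]; field_simp
  have hβ2 : β ≤ 1 / 2 := by nlinarith
  obtain ⟨g, f, hgb, hg, hfm, hf, rfl⟩ := hφ.exists_decomposition hβpos.le hφb
  have hfb := IsBddMeas.of_mem_Icc hfm hf
  rw [iterate_add hT hgb hfb]
  have h1 := abs_iterate_sub_le_add (σ := σ) hT hq hR hcontr hgb hβpos.le hg N x y
  have hr := norm_nonneg (x - y)
  have h2 : β * (q ^ N * ‖x - y‖ + R) ≤ β * (1 / 2 * ‖x - y‖ + R) := by gcongr
  have hI := iterate_mem_Icc (σ := σ) hT hfm hf N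
  have hsum : |(step T σ)^[N] g x + (step T σ)^[N] f x -
      ((step T σ)^[N] g y + (step T σ)^[N] f y)| ≤
      |(step T σ)^[N] g x - (step T σ)^[N] g y| + |(step T σ)^[N] f x - (step T σ)^[N] f y| := by
    rw [add_sub_add_comm]
    exact abs_add_le _ _
  refine hsum.trans ?_
  -- Near pairs gain from the overlap: `α = 1 - 2β(R + 1)` absorbs `βR`. Far pairs gain from the
  -- halved slope, since `β‖x - y‖ / 4` exceeds `β(R + 1)`.
  rcases le_or_gt ‖x - y‖ (4 * (R + 1)) with hxy | hxy
  · have h3 : |(step T σ)^[N] f x - (step T σ)^[N] f y| ≤ α := by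
      rw [abs_le]
      have ha := hα f hfm hf x y hxy
      have hb := hα f hfm hf y x (by rwa [norm_sub_rev])
      constructor <;> linarith
    have h4 : 0 ≤ β * ‖x - y‖ * (1 / 2 - β / 2) :=
      mul_nonneg (by positivity) (by linarith)
    nlinarith
  · have h3 : |(step T σ)^[N] f x - (step T σ)^[N] f y| ≤ 1 := by
      rw [abs_le]
      have ha := hI x
      have hb := hI y
      constructor <;> linarith [ha.1, ha.2, hb.1, hb.2]
    have h4 : β * (4 * (R + 1)) * (1 / 4) ≤ β * ‖x - y‖ * (1 / 2 - β / 2) := by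
      have : β * (4 * (R + 1)) ≤ β * ‖x - y‖ := by gcongr
      exact mul_le_mul this (by linarith) (by norm_num) (by positivity)
    nlinarith

end Contraction

end GaussianChain

namespace GaussianChain

/-! ### Stationary laws and their moments -/

section Invariant

open Filter Topology

variable {E : Type*} [NormedAddCommGroup E] [InnerProductSpace ℝ E] [FiniteDimensional ℝ E]
  [MeasurableSpace E] [BorelSpace E] {T : E → E} {σ : ℝ} {φ : E → ℝ} {π : Measure E}

/-- Invariance of `π` under the chain `x ↦ T x + σ z` with standard Gaussian noise `z`. -/
def IsStationary (T : E → E) (σ : ℝ) (π : Measure E) : Prop :=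
  (π.prod (stdGaussian E)).map (fun p => T p.1 + σ • p.2) = π

lemma IsStationary.integral_step [IsProbabilityMeasure π] (h : IsStationary T σ π)
    (hT : Measurable T) (hφ : IsBddMeas φ) : ∫ x, step T σ φ x ∂π = ∫ x, φ x ∂π := by
  have hm : Measurable (fun p : E × E => T p.1 + σ • p.2) := by fun_prop
  conv_rhs => rw [← h]
  rw [integral_map hm.aemeasurable hφ.1.aestronglyMeasurable, integral_prod]
  · rfl
  · exact integrable_of_bounded (hφ.1.comp hm) fun p => hφ.2.choose_spec _

lemma IsStationary.integral_iterate [IsProbabilityMeasure π] (h : IsStationary T σ π)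
    (hT : Measurable T) (hφ : IsBddMeas φ) (k : ℕ) :
    ∫ x, (step T σ)^[k] φ x ∂π = ∫ x, φ x ∂π := by
  induction k with
  | zero => rfl
  | succ k ih => rw [Function.iterate_succ_apply', h.integral_step hT (hφ.iterate hT k), ih]

lemma integrable_sq_norm_add_smul (a : E) (σ : ℝ) :
    Integrable (fun z => ‖a + σ • z‖ ^ 2) (stdGaussian E) := by
  have h : MemLp (fun z : E => a + σ • z) 2 (stdGaussian E) :=
    (memLp_const a).add (IsGaussian.memLp_two_id.const_smul σ)
  exact h.integrable_norm_pow (by norm_num)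

/-- Convexity of the square, `(q u + v)² ≤ q u² + v² / (1 - q)`, turns the linear growth bound into
a drift condition for `‖x‖²`. -/
lemma exists_integral_sq_norm_le {q c : ℝ} (hq0 : 0 ≤ q) (hq : q < 1) (_hc : 0 ≤ c)
    (hT : ∀ x, ‖T x‖ ≤ q * ‖x‖ + c) (σ : ℝ) : ∃ D, 0 ≤ D ∧ ∀ x,
      ∫ z, ‖T x + σ • z‖ ^ 2 ∂(stdGaussian E) ≤ q * ‖x‖ ^ 2 + (1 - q) * D := by
  have hint : Integrable (fun z : E => (c + ‖σ • z‖) ^ 2) (stdGaussian E) := by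
    have h : MemLp (fun z : E => c + ‖σ • z‖) 2 (stdGaussian E) :=
      (memLp_const c).add (IsGaussian.memLp_two_id.const_smul σ).norm
    have := h.integrable_norm_pow (by norm_num)
    simpa using this
  have h1q : 0 < 1 - q := by linarith
  refine ⟨(∫ z : E, (c + ‖σ • z‖) ^ 2 ∂(stdGaussian E)) / (1 - q) ^ 2,
    div_nonneg (integral_nonneg fun z => by positivity) (by positivity), fun x => ?_⟩
  have hpt : ∀ z, ‖T x + σ • z‖ ^ 2 ≤ q * ‖x‖ ^ 2 + (1 - q)⁻¹ * (c + ‖σ • z‖) ^ 2 := by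
    intro z
    have h1 : ‖T x + σ • z‖ ≤ q * ‖x‖ + (c + ‖σ • z‖) := by
      linarith [norm_add_le (T x) (σ • z), hT x]
    have h2 : ‖T x + σ • z‖ ^ 2 ≤ (q * ‖x‖ + (c + ‖σ • z‖)) ^ 2 :=
      pow_le_pow_left₀ (norm_nonneg _) h1 2
    refine h2.trans ?_
    set u := ‖x‖
    set v := c + ‖σ • z‖
    have h3 : q * u ^ 2 + (1 - q)⁻¹ * v ^ 2 - (q * u + v) ^ 2 =
        q * (1 - q)⁻¹ * ((1 - q) * u - v) ^ 2 := by
      field_simp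
      ring
    have h4 : 0 ≤ q * (1 - q)⁻¹ * ((1 - q) * u - v) ^ 2 := by positivity
    linarith
  refine (integral_mono (integrable_sq_norm_add_smul _ _)
    ((integrable_const _).add (hint.const_mul _)) hpt).trans_eq ?_
  rw [integral_add' (integrable_const _) (hint.const_mul _), integral_const_mul (1 - q)⁻¹]
  simp only [integral_const, probReal_univ, one_smul]
  generalize ∫ z : E, (c + ‖σ • z‖) ^ 2 ∂(stdGaussian E) = I
  field_simp

/-- The second moment may not be subtracted before it is known to be finite, so the drift condition
is iterated under truncation at `n`. Each step maps `g k` below `g (k + 1)`, and stationarity makes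
`∫ g k` nondecreasing, with limit `min D n`. -/
lemma IsStationary.integral_min_sq_norm_le [IsProbabilityMeasure π] (h : IsStationary T σ π)
    (hTm : Measurable T) {q D : ℝ} (hq0 : 0 ≤ q) (hq : q < 1) (hD : 0 ≤ D)
    (hT : ∀ x, ∫ z, ‖T x + σ • z‖ ^ 2 ∂(stdGaussian E) ≤ q * ‖x‖ ^ 2 + (1 - q) * D) (n : ℕ) :
    ∫ x, min (‖x‖ ^ 2) (n : ℝ) ∂π ≤ D := by
  set g : ℕ → E → ℝ := fun k x => min (q ^ k * ‖x‖ ^ 2 + (1 - q ^ k) * D) n with hg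
  have hqk : ∀ k, 0 ≤ 1 - q ^ k := fun k => by linarith [pow_le_one₀ hq0 hq.le (n := k)]
  have hg0 : ∀ k x, g k x ∈ Icc (0 : ℝ) n := by
    intro k x
    have := hqk k
    exact ⟨le_min (by positivity) (Nat.cast_nonneg n), min_le_right _ _⟩
  have hgm : ∀ k, Measurable (g k) := fun k => by fun_prop
  have hgb : ∀ k, IsBddMeas (g k) := fun k => .of_mem_Icc (hgm k) (hg0 k)
  have hstep : ∀ k, ∫ x, g k x ∂π ≤ ∫ x, g (k + 1) x ∂π := by
    intro k
    rw [← h.integral_step hTm (hgb k)]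
    refine integral_mono ((hgb k).step hTm).integrable (hgb (k + 1)).integrable fun x => ?_
    refine le_min ?_ (step_mem_Icc (hgm k) (hg0 k) x).2
    have hi := integrable_sq_norm_add_smul (T x) σ
    calc step T σ (g k) x
        ≤ ∫ z, (q ^ k * ‖T x + σ • z‖ ^ 2 + (1 - q ^ k) * D) ∂(stdGaussian E) :=
          integral_mono ((hgb k).integrable_comp _ _)
            ((hi.const_mul _).add (integrable_const _)) fun z => min_le_left _ _
      _ = q ^ k * ∫ z, ‖T x + σ • z‖ ^ 2 ∂(stdGaussian E) + (1 - q ^ k) * D := by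
          rw [integral_add (hi.const_mul _) (integrable_const _), integral_const_mul]
          simp
      _ ≤ q ^ k * (q * ‖x‖ ^ 2 + (1 - q) * D) + (1 - q ^ k) * D := by
          have := mul_le_mul_of_nonneg_left (hT x) (pow_nonneg hq0 k)
          linarith
      _ = _ := by ring
  have hmono : ∀ k, ∫ x, g 0 x ∂π ≤ ∫ x, g k x ∂π := by
    intro k
    induction k with
    | zero => exact le_rfl
    | succ k ih => exact ih.trans (hstep k)
  have hlim : Tendsto (fun k => ∫ x, g k x ∂π) atTop (𝓝 (∫ _, min D n ∂π)) := by
    refine tendsto_integral_of_dominated_convergence (fun _ => (n : ℝ))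
      (fun k => (hgm k).aestronglyMeasurable) (integrable_const _)
      (fun k => ae_of_all _ fun x => ?_) (ae_of_all _ fun x => ?_)
    · rw [Real.norm_eq_abs, abs_of_nonneg (hg0 k x).1]
      exact (hg0 k x).2
    · have hp := tendsto_pow_atTop_nhds_zero_of_lt_one hq0 hq
      have h1 : Tendsto (fun k => q ^ k * ‖x‖ ^ 2 + (1 - q ^ k) * D) atTop
          (𝓝 (0 * ‖x‖ ^ 2 + (1 - 0) * D)) :=
        (hp.mul_const _).add ((hp.const_sub 1).mul_const _)
      have h2 := h1.min (tendsto_const_nhds (x := (n : ℝ)))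
      simpa using h2
  have hle := ge_of_tendsto' hlim hmono
  simp only [integral_const, probReal_univ, one_smul, hg, pow_zero, one_mul, sub_self, zero_mul,
    add_zero] at hle
  exact hle.trans (min_le_left _ _)

/-- Stationary laws of dissipative chains have a finite second moment. -/
lemma IsStationary.memLp_two [IsProbabilityMeasure π] (h : IsStationary T σ π)
    (hTm : Measurable T) {q c : ℝ} (hq0 : 0 ≤ q) (hq : q < 1) (hc : 0 ≤ c)
    (hT : ∀ x, ‖T x‖ ≤ q * ‖x‖ + c) : MemLp (fun x : E => x) 2 π := by
  obtain ⟨D, hD0, hD⟩ := exists_integral_sq_norm_le hq0 hq hc hT σ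
  have hmin := h.integral_min_sq_norm_le hTm hq0 hq hD0 hD
  rw [memLp_two_iff_integrable_sq_norm (by fun_prop)]
  refine ⟨by fun_prop, ?_⟩
  rw [hasFiniteIntegral_iff_ofReal (ae_of_all _ fun x => by positivity)]
  -- Fatou's lemma removes the truncation, as its bound `D` does not depend on `n`.
  have hsup : ∀ x : E, ENNReal.ofReal (‖x‖ ^ 2) =
      liminf (fun n : ℕ => ENNReal.ofReal (min (‖x‖ ^ 2) n)) atTop := by
    intro x
    refine (Tendsto.liminf_eq (tendsto_const_nhds.congr' ?_)).symm
    filter_upwards [eventually_ge_atTop ⌈‖x‖ ^ 2⌉₊] with n hn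
    rw [min_eq_left (Nat.ceil_le.1 hn)]
  simp_rw [hsup]
  refine (lintegral_liminf_le fun n => by fun_prop).trans_lt ?_
  refine lt_of_le_of_lt (b := ENNReal.ofReal D) ?_ ENNReal.ofReal_lt_top
  refine liminf_le_of_le (by isBoundedDefault) fun b hb => ?_
  obtain ⟨n, hn⟩ := hb.exists
  refine hn.trans ?_
  rw [← ofReal_integral_eq_lintegral_ofReal]
  · exact ENNReal.ofReal_le_ofReal (hmin n)
  · exact integrable_of_bounded (by fun_prop) (B := n) fun x => by
      rw [abs_of_nonneg (by positivity)]
      exact min_le_right _ _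
  · exact ae_of_all _ fun x => by positivity

end Invariant

end GaussianChain

namespace GaussianChain

/-! ### Perturbation of stationary laws, uniformly in the step size -/

section Perturbation

/-- Comparison with the value at `0` makes the dual distance finite, so that it can later be
absorbed. -/
lemma OscClass.abs_integral_sub_le_of_integrable {E : Type*} [NormedAddCommGroup E]
    [MeasurableSpace E] {β : ℝ} {φ : E → ℝ} {π₁ π₂ : Measure E} [IsProbabilityMeasure π₁]
    [IsProbabilityMeasure π₂] (hm₁ : Integrable (fun x => ‖x‖) π₁)
    (hm₂ : Integrable (fun x => ‖x‖) π₂) (hφ : OscClass β φ) (hφb : IsBddMeas φ) :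
    |∫ x, φ x ∂π₁ - ∫ x, φ x ∂π₂| ≤
      (1 + β * ∫ x, ‖x‖ ∂π₁) + (1 + β * ∫ x, ‖x‖ ∂π₂) := by
  have key : ∀ π : Measure E, IsProbabilityMeasure π → Integrable (fun x => ‖x‖) π →
      |∫ x, φ x ∂π - φ 0| ≤ 1 + β * ∫ x, ‖x‖ ∂π := by
    intro π _ hm
    have h1 : ∫ x, φ x ∂π - φ 0 = ∫ x, (φ x - φ 0) ∂π := by
      rw [integral_sub hφb.integrable (integrable_const _)]
      simp
    have h2 : ∫ x, (1 + β * ‖x‖) ∂π = 1 + β * ∫ x, ‖x‖ ∂π := by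
      rw [integral_add (integrable_const _) (hm.const_mul _), integral_const_mul]
      simp
    rw [h1, ← h2, ← Real.norm_eq_abs]
    refine norm_integral_le_of_norm_le ((integrable_const _).add (hm.const_mul _))
      (ae_of_all _ fun x => ?_)
    simpa using hφ x 0
  have e : ∫ x, φ x ∂π₁ - ∫ x, φ x ∂π₂ =
      (∫ x, φ x ∂π₁ - φ 0) - (∫ x, φ x ∂π₂ - φ 0) := by ring
  rw [e]
  exact (abs_sub _ _).trans (add_le_add (key π₁ ‹_› hm₁) (key π₂ ‹_› hm₂))

variable {E : Type*} [NormedAddCommGroup E] [InnerProductSpace ℝ E] [FiniteDimensional ℝ E]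
  [MeasurableSpace E] [BorelSpace E] {T T₁ T₂ : E → E} {σ Λ β : ℝ} {φ : E → ℝ}
  {π₁ π₂ : Measure E}

/-- Lipschitz constant of the image of `OscClass β` under `k` steps of the chain and one
Gaussian convolution. -/
noncomputable def smoothLip (β Λ σ : ℝ) (k : ℕ) : ℝ :=
  β * Λ ^ k + 2 * √(Λ ^ (2 * k) / (2 * (k + 1) * σ ^ 2))

/-- The Lipschitz part of `φ` is propagated by synchronous coupling, the `[0, 1]`-valued part is
regularised by the noise. -/
lemma OscClass.abs_smooth_sub_le (hT : Measurable T) (hσ : σ ≠ 0) (hΛ : 1 ≤ Λ)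
    (hlip : ∀ x y, ‖T x - T y‖ ≤ Λ * ‖x - y‖) (hβ : 0 ≤ β) (hφ : OscClass β φ)
    (hφb : IsBddMeas φ) (k : ℕ) (a b : E) :
    |step id σ ((step T σ)^[k] φ) a - step id σ ((step T σ)^[k] φ) b| ≤
      smoothLip β Λ σ k * ‖a - b‖ := by
  obtain ⟨g, f, hgb, hg, hfm, hf, rfl⟩ := hφ.exists_decomposition hβ hφb
  have hfb := IsBddMeas.of_mem_Icc hfm hf
  rw [iterate_add hT hgb hfb, step_add (hgb.iterate hT k) (hfb.iterate hT k)]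
  have h1 := abs_step_sub_le (T := id) (σ := σ) (hgb.iterate (σ := σ) hT k) (a := β * Λ ^ k) (c := 0)
    (by simpa using abs_iterate_sub_le_pow hT (by linarith) hlip hgb hβ hg k) a b
  have h2 := GaussianChain.abs_smooth_sub_le hT hσ hΛ hlip hfm hf k a b
  rw [add_sub_add_comm]
  refine (abs_add_le _ _).trans ((add_le_add h1 h2).trans_eq ?_)
  simp only [id, smoothLip]
  ring

/-- One-step perturbation: the drift is changed at the first step only. -/
lemma OscClass.abs_integral_iterate_sub_le [IsProbabilityMeasure π₁]
    (h₁ : IsStationary T₁ σ π₁) (hT₁ : Measurable T₁) (hT₂ : Measurable T₂) (hσ : σ ≠ 0)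
    (hΛ : 1 ≤ Λ) (hlip : ∀ x y, ‖T₂ x - T₂ y‖ ≤ Λ * ‖x - y‖) (hβ : 0 ≤ β)
    (hint : Integrable (fun x => ‖T₁ x - T₂ x‖) π₁) (hφ : OscClass β φ) (hφb : IsBddMeas φ)
    (k : ℕ) :
    |∫ x, (step T₂ σ)^[k] φ x ∂π₁ - ∫ x, (step T₂ σ)^[k + 1] φ x ∂π₁| ≤
      smoothLip β Λ σ k * ∫ x, ‖T₁ x - T₂ x‖ ∂π₁ := by
  have hk : IsBddMeas ((step T₂ σ)^[k] φ) := hφb.iterate hT₂ k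
  rw [← h₁.integral_step hT₁ hk, Function.iterate_succ_apply',
    ← integral_sub (hk.step hT₁).integrable (hk.step hT₂).integrable, ← integral_const_mul,
    ← Real.norm_eq_abs]
  refine norm_integral_le_of_norm_le (hint.const_mul _) (ae_of_all _ fun x => ?_)
  exact hφ.abs_smooth_sub_le hT₂ hσ hΛ hlip hβ hφb k (T₁ x) (T₂ x)

/-- Perturbation bound for stationary laws, given a contraction of the second chain after `N`
steps. -/
lemma abs_integral_sub_le_of_contraction [IsProbabilityMeasure π₁] [IsProbabilityMeasure π₂]
    (h₁ : IsStationary T₁ σ π₁) (h₂ : IsStationary T₂ σ π₂)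
    (hT₁ : Measurable T₁) (hT₂ : Measurable T₂) (hσ : σ ≠ 0)
    (hΛ : 1 ≤ Λ) (hlip : ∀ x y, ‖T₂ x - T₂ y‖ ≤ Λ * ‖x - y‖) (hβ : 0 ≤ β)
    (hint : Integrable (fun x => ‖T₁ x - T₂ x‖) π₁)
    (hm₁ : Integrable (fun x => ‖x‖) π₁) (hm₂ : Integrable (fun x => ‖x‖) π₂)
    {γ : ℝ} (hγ0 : 0 < γ) (hγ1 : γ < 1) (N : ℕ)
    (hN : ∀ φ : E → ℝ, OscClass β φ → IsBddMeas φ → ∀ x y,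
      |(step T₂ σ)^[N] φ x - (step T₂ σ)^[N] φ y| ≤ γ * (1 + β * ‖x - y‖))
    (hφ : Measurable φ) (hφ1 : ∀ x, |φ x| ≤ 1) :
    |∫ x, φ x ∂π₁ - ∫ x, φ x ∂π₂| ≤
      2 / (1 - γ) * (∑ k ∈ Finset.range N, smoothLip β Λ σ k) * ∫ x, ‖T₁ x - T₂ x‖ ∂π₁ := by
  set S := ∑ k ∈ Finset.range N, smoothLip β Λ σ k
  set Δ := ∫ x, ‖T₁ x - T₂ x‖ ∂π₁
  -- `sSup A` is the dual distance between `π₁` and `π₂`. By `hN` the function `γ⁻¹ * P₂ᴺψ` is again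
  -- admissible, which gives the recursion `hrec`.
  set A : Set ℝ := {r | ∃ φ : E → ℝ, OscClass β φ ∧ IsBddMeas φ ∧
    r = |∫ x, φ x ∂π₁ - ∫ x, φ x ∂π₂|} with hA
  have hAb : BddAbove A := by
    refine ⟨(1 + β * ∫ x, ‖x‖ ∂π₁) + (1 + β * ∫ x, ‖x‖ ∂π₂), ?_⟩
    rintro _ ⟨ψ, hψ, hψb, rfl⟩
    exact hψ.abs_integral_sub_le_of_integrable hm₁ hm₂ hψb
  have hAne : A.Nonempty := by
    refine ⟨_, fun _ => 0, fun x y => ?_, isBddMeas_const 0, rfl⟩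
    simp only [sub_self, abs_zero]
    positivity
  have hrec : ∀ ψ : E → ℝ, OscClass β ψ → IsBddMeas ψ →
      |∫ x, ψ x ∂π₁ - ∫ x, ψ x ∂π₂| ≤ S * Δ + γ * sSup A := by
    intro ψ hψ hψb
    have h2 : |∫ x, ψ x ∂π₁ - ∫ x, (step T₂ σ)^[N] ψ x ∂π₁| ≤ S * Δ := by
      have htel := Finset.sum_range_sub' (fun k => ∫ x, (step T₂ σ)^[k] ψ x ∂π₁) N
      simp only [Function.iterate_zero, id] at htel
      rw [← htel, Finset.sum_mul]
      exact (Finset.abs_sum_le_sum_abs _ _).trans (Finset.sum_le_sum fun k _ =>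
        hψ.abs_integral_iterate_sub_le h₁ hT₁ hT₂ hσ hΛ hlip hβ hint hψb k)
    have h3 : |∫ x, (step T₂ σ)^[N] ψ x ∂π₁ - ∫ x, (step T₂ σ)^[N] ψ x ∂π₂| ≤ γ * sSup A := by
      have hmem : |∫ x, γ⁻¹ * (step T₂ σ)^[N] ψ x ∂π₁ - ∫ x, γ⁻¹ * (step T₂ σ)^[N] ψ x ∂π₂| ∈ A := by
        refine ⟨_, fun x y => ?_, (hψb.iterate hT₂ N).const_mul γ⁻¹, rfl⟩
        rw [← mul_sub, abs_mul, abs_of_pos (inv_pos.2 hγ0), inv_mul_le_iff₀ hγ0]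
        exact hN ψ hψ hψb x y
      have := le_csSup hAb hmem
      rwa [integral_const_mul, integral_const_mul, ← mul_sub, abs_mul, abs_of_pos (inv_pos.2 hγ0),
        inv_mul_le_iff₀ hγ0] at this
    rw [h₂.integral_iterate hT₂ hψb N] at h3
    have e : ∫ x, ψ x ∂π₁ - ∫ x, ψ x ∂π₂ =
      (∫ x, ψ x ∂π₁ - ∫ x, (step T₂ σ)^[N] ψ x ∂π₁) +
        (∫ x, (step T₂ σ)^[N] ψ x ∂π₁ - ∫ x, ψ x ∂π₂) := by ring
    rw [e]
    exact (abs_add_le _ _).trans (add_le_add h2 h3)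
  have hsup : sSup A ≤ S * Δ + γ * sSup A := by
    refine csSup_le hAne ?_
    rintro _ ⟨ψ, hψ, hψb, rfl⟩
    exact hrec ψ hψ hψb
  -- Halving brings the oscillation of `φ` down to at most `1`; this is the factor `2` in the bound.
  have hhalf : |∫ x, 1 / 2 * φ x ∂π₁ - ∫ x, 1 / 2 * φ x ∂π₂| ≤ sSup A := by
    refine le_csSup hAb ⟨_, fun x y => ?_, (IsBddMeas.const_mul ⟨hφ, 1, hφ1⟩ (1 / 2)), rfl⟩
    rw [← mul_sub, abs_mul, abs_of_pos (by norm_num : (0 : ℝ) < 1 / 2)]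
    have h1 := (abs_sub (φ x) (φ y)).trans (add_le_add (hφ1 x) (hφ1 y))
    have h2 : 0 ≤ β * ‖x - y‖ := by positivity
    linarith
  rw [integral_const_mul, integral_const_mul, ← mul_sub, abs_mul,
    abs_of_pos (by norm_num : (0 : ℝ) < 1 / 2)] at hhalf
  have h1γ : 0 < 1 - γ := by linarith
  have hfin : sSup A ≤ S * Δ / (1 - γ) := by
    rw [le_div_iff₀ h1γ]
    linarith
  have e : 2 / (1 - γ) * S * Δ = 2 * (S * Δ / (1 - γ)) := by ring
  rw [e]
  linarith

lemma sum_inv_sqrt_le (N : ℕ) :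
    ∑ k ∈ Finset.range N, (√((k : ℝ) + 1))⁻¹ ≤ 2 * √(N : ℝ) := by
  induction N with
  | zero => simp
  | succ N ih =>
    rw [Finset.sum_range_succ]
    push_cast
    have hs : 0 < √((N : ℝ) + 1) := by positivity
    have h1 : √((N : ℝ) + 1) ^ 2 = N + 1 := Real.sq_sqrt (by positivity)
    have h2 : √(N : ℝ) ^ 2 = N := Real.sq_sqrt (by positivity)
    have h3 : (√((N : ℝ) + 1))⁻¹ * √((N : ℝ) + 1) = 1 := inv_mul_cancel₀ hs.ne'
    have h4 : (√((N : ℝ) + 1))⁻¹ ≤ 2 * √((N : ℝ) + 1) - 2 * √(N : ℝ) := by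
      rw [inv_le_iff_one_le_mul₀ hs]
      nlinarith [sq_nonneg (√((N : ℝ) + 1) - √(N : ℝ))]
    linarith

lemma one_add_mul_pow_le_exp {K δ t : ℝ} (hK : 0 ≤ K) (hδ : 0 ≤ δ) {k : ℕ} (hk : k * δ ≤ t) :
    (1 + δ * K) ^ k ≤ Real.exp (K * t) := by
  calc (1 + δ * K) ^ k ≤ Real.exp (δ * K) ^ k := by
        gcongr
        linarith [Real.add_one_le_exp (δ * K)]
    _ = Real.exp (K * (k * δ)) := by rw [← Real.exp_nat_mul]; congr 1; ring
    _ ≤ _ := by gcongr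

/-- The weight `δ` beats the singularity `(δ(k+1))^(-1/2)` of the smoothing constants, so the bound
depends only on the elapsed time `t`. -/
lemma mul_sum_smoothLip_le {K δ t : ℝ} (hK : 0 ≤ K) (hδ : 0 < δ) (hβ : 0 ≤ β) {N : ℕ}
    (hN : N * δ ≤ t) :
    δ * ∑ k ∈ Finset.range N, smoothLip β (1 + δ * K) √(2 * δ) k ≤
      Real.exp (K * t) * (β * t + 2 * √t) := by
  have hterm : ∀ k ∈ Finset.range N, smoothLip β (1 + δ * K) √(2 * δ) k ≤
      Real.exp (K * t) * (β + (√δ)⁻¹ * (√((k : ℝ) + 1))⁻¹) := by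
    intro k hk
    have hkN : (k : ℝ) * δ ≤ t :=
      le_trans (by gcongr; exact (Finset.mem_range.1 hk).le) hN
    have hpow := one_add_mul_pow_le_exp hK hδ.le hkN
    have hsq : 2 * √((1 + δ * K) ^ (2 * k) / (2 * (k + 1) * √(2 * δ) ^ 2)) =
        (1 + δ * K) ^ k * ((√δ)⁻¹ * (√((k : ℝ) + 1))⁻¹) := by
      rw [Real.sq_sqrt (by positivity)]
      have : (1 + δ * K) ^ (2 * k) / (2 * (k + 1) * (2 * δ)) =
          ((1 + δ * K) ^ k * ((√δ)⁻¹ * (√((k : ℝ) + 1))⁻¹) / 2) ^ 2 := by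
        rw [div_pow, mul_pow, mul_pow, inv_pow, inv_pow, Real.sq_sqrt hδ.le,
          Real.sq_sqrt (by positivity)]
        field_simp
        ring
      rw [this, Real.sqrt_sq (by positivity)]
      ring
    rw [smoothLip, hsq, mul_add, mul_comm β]
    gcongr
  have hsum : ∑ k ∈ Finset.range N, smoothLip β (1 + δ * K) √(2 * δ) k ≤
      Real.exp (K * t) * (N * β + (√δ)⁻¹ * (2 * √(N : ℝ))) := by
    refine (Finset.sum_le_sum hterm).trans ?_
    rw [← Finset.mul_sum, Finset.sum_add_distrib, ← Finset.mul_sum]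
    simp only [Finset.sum_const, Finset.card_range, nsmul_eq_mul]
    gcongr
    exact sum_inv_sqrt_le N
  refine (mul_le_mul_of_nonneg_left hsum hδ.le).trans ?_
  have h1 : δ * (Real.exp (K * t) * (N * β + (√δ)⁻¹ * (2 * √(N : ℝ)))) =
      Real.exp (K * t) * (β * (N * δ) + 2 * √(N * δ)) := by
    rw [Real.sqrt_mul (by positivity)]
    have : δ * (√δ)⁻¹ = √δ := by
      rw [← div_eq_mul_inv, Real.div_sqrt]
    linear_combination Real.exp (K * t) * (2 * √(N : ℝ)) * this
  rw [h1]
  gcongr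

/-- Perturbation bound for the stationary laws of discretised Langevin chains whose drift is
Lipschitz and dissipative at infinity, uniformly in the step size. -/
theorem exists_perturbation_const {K κ R δm : ℝ} (hK : 0 ≤ K) (hκ : 0 < κ) (hR : 0 ≤ R)
    (hδm : κ * δm ≤ 1) : ∃ A : ℝ, 0 ≤ A ∧ ∀ δ ∈ Ioc (0 : ℝ) δm, ∀ b₁ b₂ : E → E,
      Measurable b₁ → Measurable b₂ →
      (∀ x y, ‖(x + δ • b₂ x) - (y + δ • b₂ y)‖ ≤ (1 + δ * K) * ‖x - y‖) →
      (∀ x y, ‖(x + δ • b₂ x) - (y + δ • b₂ y)‖ ≤ (1 - κ * δ) * ‖x - y‖ + κ * δ * R) →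
      ∀ π₁ π₂ : Measure E, IsProbabilityMeasure π₁ → IsProbabilityMeasure π₂ →
      IsStationary (fun x => x + δ • b₁ x) √(2 * δ) π₁ →
      IsStationary (fun x => x + δ • b₂ x) √(2 * δ) π₂ →
      Integrable (fun x => ‖x‖) π₁ → Integrable (fun x => ‖x‖) π₂ →
      Integrable (fun x => ‖b₁ x - b₂ x‖) π₁ →
      ∀ φ : E → ℝ, Measurable φ → (∀ x, |φ x| ≤ 1) →
      |∫ x, φ x ∂π₁ - ∫ x, φ x ∂π₂| ≤ A * ∫ x, ‖b₁ x - b₂ x‖ ∂π₁ := by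
  rcases le_or_gt δm 0 with hδm0 | hδm0
  · exact ⟨0, le_rfl, fun δ hδ => absurd hδ.1 (by linarith [hδ.2])⟩
  -- The chain is run for `N = ⌈1 / (κδ)⌉` steps, so `Nδ` lies between `1 / κ` and `t`. `C` bounds
  -- the Harnack exponent for starting points within `4 * (R + 1)`, and `m` is the resulting
  -- overlap.
  set t : ℝ := 1 / κ + δm with ht
  set C : ℝ := Real.exp (K * t) ^ 2 / (4 / κ) * (4 * (R + 1)) ^ 2 with hC
  set m : ℝ := min (1 / 2) (Real.exp (-(2 * (Real.log 2 + C)))) with hm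
  have hm0 : 0 < m := lt_min (by norm_num) (Real.exp_pos _)
  have hm1 : m ≤ 1 / 2 := min_le_left _ _
  set β : ℝ := (1 - (1 - m)) / (2 * (R + 1)) with hβ
  have hβ0 : 0 < β := div_pos (by linarith) (by linarith)
  have hβ1 : β < 1 := by
    rw [hβ, div_lt_one (by linarith)]
    linarith
  refine ⟨2 / (β / 2) * (Real.exp (K * t) * (β * t + 2 * √t)), by positivity, ?_⟩
  intro δ hδ b₁ b₂ hb₁ hb₂ hlip hcontr π₁ π₂ _ _ h₁ h₂ hm₁ hm₂ hint φ hφ hφ1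
  have hδ0 := hδ.1
  have hκδ : κ * δ ≤ 1 := (mul_le_mul_of_nonneg_left hδ.2 hκ.le).trans hδm
  have hT₁ : Measurable (fun x => x + δ • b₁ x) := by fun_prop
  have hT₂ : Measurable (fun x => x + δ • b₂ x) := by fun_prop
  have hσ : √(2 * δ) ≠ 0 := by positivity
  have hΛ : 1 ≤ 1 + δ * K := by
    have := mul_nonneg hδ0.le hK
    linarith
  have hdiff : ∀ x, ‖x + δ • b₁ x - (x + δ • b₂ x)‖ = δ * ‖b₁ x - b₂ x‖ := by
    intro x
    rw [add_sub_add_left_eq_sub, ← smul_sub, norm_smul, Real.norm_eq_abs, abs_of_pos hδ0]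
  -- `N = k + 1` because the smoothing lemmas start with a noise: `N` steps are one application of
  -- the drift map followed by the smoothing with index `k`.
  obtain ⟨k, hk⟩ : ∃ k, ⌈1 / κ / δ⌉₊ = k + 1 :=
    Nat.exists_eq_succ_of_ne_zero (Nat.ceil_pos.2 (by positivity)).ne'
  have hkl : 1 / κ ≤ ((k + 1 : ℕ) : ℝ) * δ := by
    rw [← div_le_iff₀ hδ0, ← hk]
    exact Nat.le_ceil _
  have hku : ((k + 1 : ℕ) : ℝ) * δ ≤ t := by
    have h1 := (Nat.ceil_lt_add_one (show 0 ≤ 1 / κ / δ by positivity)).le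
    rw [hk] at h1
    have h2 := mul_le_mul_of_nonneg_right h1 hδ0.le
    rw [add_mul, div_mul_cancel₀ _ hδ0.ne', one_mul] at h2
    linarith [hδ.2]
  have hqN : (1 - κ * δ) ^ (k + 1) ≤ 1 / 2 := by
    calc (1 - κ * δ) ^ (k + 1) ≤ Real.exp (-(κ * δ)) ^ (k + 1) := by
          gcongr
          linarith [Real.add_one_le_exp (-(κ * δ))]
      _ = Real.exp (-(κ * ((k + 1 : ℕ) * δ))) := by
          rw [← Real.exp_nat_mul]; congr 1; ring
      _ ≤ Real.exp (-1) := by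
          gcongr
          have := mul_le_mul_of_nonneg_left hkl hκ.le
          rwa [mul_one_div_cancel hκ.ne'] at this
      _ ≤ 1 / 2 := by
          rw [Real.exp_neg, one_div]
          gcongr
          linarith [Real.add_one_le_exp (1 : ℝ)]
  have hover : ∀ f : E → ℝ, Measurable f → (∀ x, f x ∈ Icc (0 : ℝ) 1) → ∀ x y,
      ‖x - y‖ ≤ 4 * (R + 1) → (step (fun x => x + δ • b₂ x) √(2 * δ))^[k + 1] f x -
        (step (fun x => x + δ • b₂ x) √(2 * δ))^[k + 1] f y ≤ 1 - m := by
    intro f hf hf01 x y hxy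
    rw [Function.iterate_succ_apply']
    refine smooth_sub_le_one_sub hT₂ hσ hΛ hlip hf hf01 k _ _ ?_
    have h1 : ‖(x + δ • b₂ x) - (y + δ • b₂ y)‖ ≤ (1 + δ * K) * (4 * (R + 1)) :=
      (hlip x y).trans (by gcongr)
    have h2 := one_add_mul_pow_le_exp hK hδ0.le hku
    rw [Real.sq_sqrt (by positivity)]
    calc _ ≤ (1 + δ * K) ^ (2 * k) / (2 * (k + 1) * (2 * δ)) *
          ((1 + δ * K) * (4 * (R + 1))) ^ 2 := by gcongr
      _ = ((1 + δ * K) ^ (k + 1)) ^ 2 / (4 * ((k + 1 : ℕ) * δ)) * (4 * (R + 1)) ^ 2 := by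
          push_cast
          field_simp
          ring
      _ ≤ Real.exp (K * t) ^ 2 / (4 * (1 / κ)) * (4 * (R + 1)) ^ 2 := by gcongr
      _ = C := by rw [hC]; ring
  have hN : ∀ ψ : E → ℝ, OscClass β ψ → IsBddMeas ψ → ∀ x y,
      |(step (fun x => x + δ • b₂ x) √(2 * δ))^[k + 1] ψ x -
        (step (fun x => x + δ • b₂ x) √(2 * δ))^[k + 1] ψ y| ≤
      (1 - β / 2) * (1 + β * ‖x - y‖) := fun ψ hψ hψb =>
    hψ.abs_iterate_sub_le hT₂ (q := 1 - κ * δ) (R := R) (α := 1 - m) (by linarith) hR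
      (by simpa using hcontr) hqN (by linarith) (by linarith) hover hβ hψb
  have hmain := abs_integral_sub_le_of_contraction h₁ h₂ hT₁ hT₂ hσ hΛ hlip hβ0.le
    (by simp_rw [hdiff]; exact hint.const_mul δ) hm₁ hm₂ (by linarith) (by linarith) (k + 1)
    hN hφ hφ1
  simp_rw [hdiff] at hmain
  rw [integral_const_mul, sub_sub_cancel] at hmain
  refine hmain.trans ?_
  have hI : 0 ≤ ∫ x, ‖b₁ x - b₂ x‖ ∂π₁ := integral_nonneg fun x => norm_nonneg _
  calc _ = 2 / (β / 2) * (δ * ∑ k ∈ Finset.range (k + 1), smoothLip β (1 + δ * K) √(2 * δ) k) *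
        ∫ x, ‖b₁ x - b₂ x‖ ∂π₁ := by ring
    _ ≤ _ := mul_le_mul_of_nonneg_right (mul_le_mul_of_nonneg_left
        (mul_sum_smoothLip_le hK hδ0 hβ0.le hku) (by positivity)) hI

end Perturbation

end GaussianChain

namespace PnPULA

/-! ### The projection onto `S` -/

section Projection

variable {d : ℕ} {S : Set (EuclideanSpace ℝ (Fin d))}

lemma proj_spec (hne : S.Nonempty) (hc : IsCompact S) (x : EuclideanSpace ℝ (Fin d)) :
    proj S x ∈ S ∧ ∀ w ∈ S, dist x (proj S x) ≤ dist x w := by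
  have h : ∃ z ∈ S, ∀ w ∈ S, dist x z ≤ dist x w := by
    obtain ⟨z, hz, hmin⟩ := hc.exists_isMinOn hne
      (f := fun w => dist x w) (continuous_const.dist continuous_id).continuousOn
    exact ⟨z, hz, fun w hw => hmin hw⟩
  rw [proj, dif_pos h]
  exact h.choose_spec

lemma inner_sub_proj_le_zero (hne : S.Nonempty) (hconv : Convex ℝ S) (hc : IsCompact S)
    (x : EuclideanSpace ℝ (Fin d)) {w : EuclideanSpace ℝ (Fin d)} (hw : w ∈ S) :
    inner ℝ (x - proj S x) (w - proj S x) ≤ 0 := by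
  obtain ⟨hmem, hmin⟩ := proj_spec hne hc x
  refine (norm_eq_iInf_iff_real_inner_le_zero hconv hmem).1 ?_ w hw
  have : Nonempty S := hne.to_subtype
  refine le_antisymm (le_ciInf fun w => ?_) (ciInf_le ⟨0, ?_⟩ (⟨_, hmem⟩ : S))
  · simpa [dist_eq_norm] using hmin w w.2
  · rintro _ ⟨w, rfl⟩
    exact norm_nonneg _

/-- The projection onto a compact convex set is nonexpansive. -/
lemma norm_proj_sub_proj_le (hne : S.Nonempty) (hconv : Convex ℝ S) (hc : IsCompact S)
    (x y : EuclideanSpace ℝ (Fin d)) : ‖proj S x - proj S y‖ ≤ ‖x - y‖ := by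
  have h1 := inner_sub_proj_le_zero hne hconv hc x (proj_spec hne hc y).1
  have h2 := inner_sub_proj_le_zero hne hconv hc y (proj_spec hne hc x).1
  set u := proj S x
  set v := proj S y
  have h3 : ‖u - v‖ ^ 2 = inner ℝ (x - y) (u - v) + inner ℝ (x - u) (v - u) +
      inner ℝ (y - v) (u - v) := by
    rw [← real_inner_self_eq_norm_sq, ← neg_sub u v, inner_neg_right, ← sub_eq_add_neg,
      ← inner_sub_left, ← inner_add_left]
    congr 1
    abel
  have h4 := real_inner_le_norm (x - y) (u - v)
  rcases (norm_nonneg (u - v)).eq_or_lt with h0 | h0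
  · rw [← h0]
    exact norm_nonneg _
  · nlinarith

lemma norm_proj_sub_proj_le_diam (hne : S.Nonempty) (hc : IsCompact S)
    (x y : EuclideanSpace ℝ (Fin d)) : ‖proj S x - proj S y‖ ≤ Metric.diam S := by
  rw [← dist_eq_norm]
  exact Metric.dist_le_diam_of_mem hc.isBounded (proj_spec hne hc x).1 (proj_spec hne hc y).1

end Projection

/-! ### Estimates for the PnP-ULA drift -/

section Drift

variable {n d : ℕ} {p : EuclideanSpace ℝ (Fin n) → EuclideanSpace ℝ (Fin d) → ℝ}
  {y : EuclideanSpace ℝ (Fin n)} {S : Set (EuclideanSpace ℝ (Fin d))} {L M ε lam δ : ℝ}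
  {D D₁ D₂ : EuclideanSpace ℝ (Fin d) → EuclideanSpace ℝ (Fin d)}
  {π : Measure (EuclideanSpace ℝ (Fin d))}

lemma norm_score_add_denoiser_sub_le (hp : SmoothForwardModel p L) (hε : 0 < ε)
    (hD : LipschitzDenoiser D M) (x₁ x₂ : EuclideanSpace ℝ (Fin d)) :
    ‖(likScore p y x₁ + (1 / ε) • (D x₁ - x₁)) - (likScore p y x₂ + (1 / ε) • (D x₂ - x₂))‖ ≤
      (L + (M + 1) / ε) * ‖x₁ - x₂‖ := by
  have e : (likScore p y x₁ + (1 / ε) • (D x₁ - x₁)) -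
      (likScore p y x₂ + (1 / ε) • (D x₂ - x₂)) =
      (likScore p y x₁ - likScore p y x₂) + (1 / ε) • ((D x₁ - D x₂) - (x₁ - x₂)) := by
    module
  rw [e]
  have h1 := hp.lipschitz y x₁ x₂
  have h2 : ‖(D x₁ - D x₂) - (x₁ - x₂)‖ ≤ M * ‖x₁ - x₂‖ + ‖x₁ - x₂‖ :=
    (norm_sub_le _ _).trans (add_le_add (hD x₁ x₂) le_rfl)
  refine (norm_add_le _ _).trans ?_
  rw [norm_smul, Real.norm_of_nonneg (by positivity : 0 ≤ 1 / ε)]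
  calc _ ≤ L * ‖x₁ - x₂‖ + 1 / ε * (M * ‖x₁ - x₂‖ + ‖x₁ - x₂‖) := by gcongr
    _ = _ := by ring

lemma norm_drift_sub_le (hp : SmoothForwardModel p L) (hε : 0 < ε) (hlam : 0 < lam)
    (hne : S.Nonempty) (hconv : Convex ℝ S) (hc : IsCompact S)
    (hD : LipschitzDenoiser D M) (x₁ x₂ : EuclideanSpace ℝ (Fin d)) :
    ‖drift p y S lam ε D x₁ - drift p y S lam ε D x₂‖ ≤
      (L + (M + 1) / ε + 2 / lam) * ‖x₁ - x₂‖ := by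
  have e : drift p y S lam ε D x₁ - drift p y S lam ε D x₂ =
      ((likScore p y x₁ + (1 / ε) • (D x₁ - x₁)) - (likScore p y x₂ + (1 / ε) • (D x₂ - x₂))) +
        (1 / lam) • ((proj S x₁ - proj S x₂) - (x₁ - x₂)) := by
    simp only [drift]
    module
  rw [e]
  have h1 := norm_score_add_denoiser_sub_le (y := y) hp hε hD x₁ x₂
  have h2 : ‖(proj S x₁ - proj S x₂) - (x₁ - x₂)‖ ≤ ‖x₁ - x₂‖ + ‖x₁ - x₂‖ :=
    (norm_sub_le _ _).trans (add_le_add (norm_proj_sub_proj_le hne hconv hc x₁ x₂) le_rfl)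
  refine (norm_add_le _ _).trans ?_
  rw [norm_smul, Real.norm_of_nonneg (by positivity : 0 ≤ 1 / lam)]
  calc _ ≤ (L + (M + 1) / ε) * ‖x₁ - x₂‖ + 1 / lam * (‖x₁ - x₂‖ + ‖x₁ - x₂‖) := by gcongr
    _ = _ := by ring

lemma norm_add_smul_drift_sub_le (hp : SmoothForwardModel p L) (hε : 0 < ε) (hlam : 0 < lam)
    (hne : S.Nonempty) (hconv : Convex ℝ S) (hc : IsCompact S)
    (hD : LipschitzDenoiser D M) (hδ : 0 < δ) (x₁ x₂ : EuclideanSpace ℝ (Fin d)) :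
    ‖(x₁ + δ • drift p y S lam ε D x₁) - (x₂ + δ • drift p y S lam ε D x₂)‖ ≤
      (1 + δ * (L + (M + 1) / ε + 2 / lam)) * ‖x₁ - x₂‖ := by
  rw [add_sub_add_comm, ← smul_sub]
  refine (norm_add_le _ _).trans ?_
  rw [norm_smul, Real.norm_of_nonneg hδ.le]
  have := mul_le_mul_of_nonneg_left
    (norm_drift_sub_le (y := y) hp hε hlam hne hconv hc hD x₁ x₂) hδ.le
  linarith

/-- One deterministic step is a contraction up to an additive constant. -/
lemma norm_add_smul_drift_sub_le_diam (hp : SmoothForwardModel p L) (hε : 0 < ε) (hlam : 0 < lam)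
    (hlam' : 2 * lam * (L + (M + 1) / ε) ≤ 1) (hne : S.Nonempty) (hc : IsCompact S)
    (hD : LipschitzDenoiser D M) (hδ : 0 < δ) (hδlam : δ ≤ lam)
    (x₁ x₂ : EuclideanSpace ℝ (Fin d)) :
    ‖(x₁ + δ • drift p y S lam ε D x₁) - (x₂ + δ • drift p y S lam ε D x₂)‖ ≤
      (1 - 1 / (2 * lam) * δ) * ‖x₁ - x₂‖ + 1 / (2 * lam) * δ * (2 * Metric.diam S) := by
  -- The linear pull `-x / lam` is kept with the identity, giving the factor `1 - δ / lam`. By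
  -- `hlam'` the score and denoiser undo at most half of this gain, and the projections differ by at
  -- most the diameter of `S`.
  have e : (x₁ + δ • drift p y S lam ε D x₁) - (x₂ + δ • drift p y S lam ε D x₂) =
      (1 - δ / lam) • (x₁ - x₂) +
      δ • ((likScore p y x₁ + (1 / ε) • (D x₁ - x₁)) -
        (likScore p y x₂ + (1 / ε) • (D x₂ - x₂))) +
      (δ / lam) • (proj S x₁ - proj S x₂) := by
    simp only [drift]
    module
  have hq : 0 ≤ 1 - δ / lam := by
    rw [sub_nonneg, div_le_one hlam]
    exact hδlam
  have h1 := norm_score_add_denoiser_sub_le (y := y) hp hε hD x₁ x₂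
  have h2 := norm_proj_sub_proj_le_diam hne hc x₁ x₂
  have h3 : L + (M + 1) / ε ≤ 1 / (2 * lam) := by
    rw [le_div_iff₀ (by positivity)]
    linarith
  have h4 : (L + (M + 1) / ε) * ‖x₁ - x₂‖ ≤ 1 / (2 * lam) * ‖x₁ - x₂‖ :=
    mul_le_mul_of_nonneg_right h3 (norm_nonneg _)
  rw [e]
  refine (norm_add₃_le).trans ?_
  rw [norm_smul, norm_smul, norm_smul, Real.norm_of_nonneg hq, Real.norm_of_nonneg hδ.le,
    Real.norm_of_nonneg (by positivity : 0 ≤ δ / lam)]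
  calc _ ≤ (1 - δ / lam) * ‖x₁ - x₂‖ + δ * (1 / (2 * lam) * ‖x₁ - x₂‖) +
        δ / lam * Metric.diam S := by
        gcongr
        exact h1.trans h4
    _ = _ := by
        field_simp
        ring

lemma continuous_of_norm_sub_le {E : Type*} [NormedAddCommGroup E] {f : E → E} {C : ℝ}
    (hf : ∀ x₁ x₂, ‖f x₁ - f x₂‖ ≤ C * ‖x₁ - x₂‖) : Continuous f := by
  refine (LipschitzWith.of_dist_le_mul (K := C.toNNReal) fun x₁ x₂ => ?_).continuous
  rw [dist_eq_norm, dist_eq_norm]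
  exact (hf x₁ x₂).trans (mul_le_mul_of_nonneg_right (Real.le_coe_toNNReal C) (norm_nonneg _))

/-- Fubini for sets: the kernel formulation of invariance is the push-forward of `π` times the
Gaussian. -/
lemma IsInvariantLaw.isStationary {b : EuclideanSpace ℝ (Fin d) → EuclideanSpace ℝ (Fin d)}
    (hb : Measurable b) (h : IsInvariantLaw b δ π) :
    GaussianChain.IsStationary (fun x => x + δ • b x) √(2 * δ) π := by
  have := h.1
  have hm : Measurable (fun q : EuclideanSpace ℝ (Fin d) × EuclideanSpace ℝ (Fin d) =>
      q.1 + δ • b q.1 + √(2 * δ) • q.2) := by fun_prop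
  refine Measure.ext fun s hs => ?_
  rw [Measure.map_apply hm hs, Measure.prod_apply (hm hs), ← h.2 s hs]
  refine lintegral_congr fun x => ?_
  rw [transition, Measure.map_apply (by fun_prop) hs]
  rfl

lemma maxStep_le (hL : 0 < L) (hε : 0 < ε) (hM : 0 ≤ M) (hlam : 0 < lam) :
    maxStep L M ε lam ≤ lam := by
  have h1 : (L + (M + 1) / ε + 1 / lam)⁻¹ ≤ lam := by
    rw [inv_le_comm₀ (by positivity) hlam, ← one_div]
    have : 0 ≤ L + (M + 1) / ε := by positivity
    linarith
  rw [maxStep]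
  linarith

lemma drift_sub_drift (x : EuclideanSpace ℝ (Fin d)) :
    drift p y S lam ε D₁ x - drift p y S lam ε D₂ x = (1 / ε) • (D₁ x - D₂ x) := by
  simp only [drift]
  module

lemma d₁_drift (hε : 0 < ε) :
    d₁ π (drift p y S lam ε D₁) (drift p y S lam ε D₂) = 1 / ε * d₁ π D₁ D₂ := by
  simp only [d₁, drift_sub_drift, norm_smul, mul_pow]
  rw [integral_const_mul, Real.sqrt_mul (by positivity), Real.norm_of_nonneg (by positivity),
    Real.sqrt_sq (by positivity)]

lemma LipschitzDenoiser.memLp_sub (hD₁ : LipschitzDenoiser D₁ M) (hD₂ : LipschitzDenoiser D₂ M)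
    [IsProbabilityMeasure π] (hπ : MemLp (fun x => x) 2 π) :
    MemLp (fun x => D₁ x - D₂ x) 2 π := by
  have hc : Continuous fun x => D₁ x - D₂ x :=
    (continuous_of_norm_sub_le hD₁).sub (continuous_of_norm_sub_le hD₂)
  have hdom : MemLp (fun x => 2 * M * ‖x‖ + ‖D₁ 0 - D₂ 0‖) 2 π :=
    (hπ.norm.const_mul (2 * M)).add (memLp_const _)
  refine hdom.mono hc.aestronglyMeasurable (ae_of_all _ fun x => ?_)
  refine le_trans ?_ (le_abs_self _)
  have e : D₁ x - D₂ x = (D₁ x - D₁ 0) - (D₂ x - D₂ 0) + (D₁ 0 - D₂ 0) := by abel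
  have h1 := hD₁ x 0
  have h2 := hD₂ x 0
  rw [sub_zero] at h1 h2
  rw [e]
  linarith [norm_add_le ((D₁ x - D₁ 0) - (D₂ x - D₂ 0)) (D₁ 0 - D₂ 0),
    norm_sub_le (D₁ x - D₁ 0) (D₂ x - D₂ 0)]

lemma integral_norm_sub_le_d₁ [IsProbabilityMeasure π]
    {f g : EuclideanSpace ℝ (Fin d) → EuclideanSpace ℝ (Fin d)}
    (h : MemLp (fun x => f x - g x) 2 π) : ∫ x, ‖f x - g x‖ ∂π ≤ d₁ π f g := by
  refine Real.le_sqrt_of_sq_le ?_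
  exact (even_two.convexOn_pow (𝕜 := ℝ)).map_integral_le (continuous_pow 2).continuousOn
    isClosed_univ (ae_of_all _ fun _ => mem_univ _) (h.integrable (by norm_num)).norm
    (h.integrable_norm_pow (by norm_num))

lemma tvDist_le {μ ν : Measure (EuclideanSpace ℝ (Fin d))} {C : ℝ}
    (h : ∀ f : EuclideanSpace ℝ (Fin d) → ℝ, Measurable f → (∀ x, |f x| ≤ 1) →
      |∫ x, f x ∂μ - ∫ x, f x ∂ν| ≤ C) : tvDist μ ν ≤ C := by
  refine csSup_le ⟨_, fun _ => 0, measurable_const, fun _ => by simp, rfl⟩ ?_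
  rintro _ ⟨f, hf, hf1, rfl⟩
  exact h f hf hf1

end Drift

end PnPULA

/-! ### The stability estimate -/

theorem corollary1 {n d : ℕ}
    -- the forward model `p(y|x)` and the observation `y`
    (p : EuclideanSpace ℝ (Fin n) → EuclideanSpace ℝ (Fin d) → ℝ)
    (y : EuclideanSpace ℝ (Fin n))
    (L : ℝ) (hL : 0 < L) (hp : PnPULA.SmoothForwardModel p L)
    (m : ℝ) (hm : PnPULA.LikelihoodMonotone p y m)
    -- the convex compact set of the projection term
    (S : Set (EuclideanSpace ℝ (Fin d)))
    (hSne : S.Nonempty) (hSconv : Convex ℝ S) (hScomp : IsCompact S)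
    -- the noise level, the Lipschitz constant of the denoisers, the projection parameter
    (ε : ℝ) (hε : 0 < ε) (M : ℝ) (hM : 0 ≤ M) (lam : ℝ) (hlam : 0 < lam)
    (hlam' : 2 * lam * (L + (M + 1) / ε - min m 0) ≤ 1) :
    ∃ A₀ A₂ B₂ : ℝ, 0 ≤ A₀ ∧ 0 ≤ A₂ ∧ 0 ≤ B₂ ∧ A₂ = A₀ / ε ∧
      ∀ δ ∈ Set.Ioc (0 : ℝ) (PnPULA.maxStep L M ε lam),
      ∀ D₁ D₂ : EuclideanSpace ℝ (Fin d) → EuclideanSpace ℝ (Fin d),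
      PnPULA.LipschitzDenoiser D₁ M → PnPULA.LipschitzDenoiser D₂ M →
      ∀ π₁ π₂ : MeasureTheory.Measure (EuclideanSpace ℝ (Fin d)),
      PnPULA.IsInvariantLaw (PnPULA.drift p y S lam ε D₁) δ π₁ →
      PnPULA.IsInvariantLaw (PnPULA.drift p y S lam ε D₂) δ π₂ →
        MeasureTheory.Integrable (fun x => ‖D₁ x - D₂ x‖ ^ 2) π₁ ∧
        PnPULA.tvDist π₁ π₂ ≤
          A₀ * PnPULA.d₁ π₁ (PnPULA.drift p y S lam ε D₁) (PnPULA.drift p y S lam ε D₂)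
            + B₂ * δ ^ (1 / 4 : ℝ) ∧
        PnPULA.tvDist π₁ π₂ ≤ A₂ * PnPULA.d₁ π₁ D₁ D₂ + B₂ * δ ^ (1 / 4 : ℝ) := by
  have hlam₀ : 2 * lam * (L + (M + 1) / ε) ≤ 1 := by
    have : 2 * lam * min m 0 ≤ 0 :=
      mul_nonpos_of_nonneg_of_nonpos (by positivity) (min_le_right _ _)
    linarith
  have hstep := PnPULA.maxStep_le hL hε hM hlam
  have hκδ : 1 / (2 * lam) * PnPULA.maxStep L M ε lam ≤ 1 := by
    rw [one_div_mul_eq_div, div_le_one (by positivity)]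
    linarith
  obtain ⟨A, hA, hmain⟩ := GaussianChain.exists_perturbation_const
    (E := EuclideanSpace ℝ (Fin d)) (K := L + (M + 1) / ε + 2 / lam) (κ := 1 / (2 * lam))
    (R := 2 * Metric.diam S) (by positivity) (by positivity)
    (mul_nonneg (by norm_num) Metric.diam_nonneg) hκδ
  -- `B₂ = 0` since `A` is uniform in `δ`; `A₂ = A / ε` since the drifts differ by `(D₁ - D₂) / ε`.
  refine ⟨A, A / ε, 0, hA, by positivity, le_rfl, rfl, ?_⟩
  intro δ hδ D₁ D₂ hD₁ hD₂ π₁ π₂ hπ₁ hπ₂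
  have hδlam : δ ≤ lam := hδ.2.trans hstep
  have hcont : ∀ D, PnPULA.LipschitzDenoiser D M → Measurable (PnPULA.drift p y S lam ε D) :=
    fun D hD => (PnPULA.continuous_of_norm_sub_le
      (PnPULA.norm_drift_sub_le hp hε hlam hSne hSconv hScomp hD)).measurable
  have hcontr : ∀ D, PnPULA.LipschitzDenoiser D M → _ := fun D hD =>
    PnPULA.norm_add_smul_drift_sub_le_diam (y := y) hp hε hlam hlam₀ hSne hScomp hD hδ.1 hδlam
  have hκ0 : 0 < 1 / (2 * lam) * δ := mul_pos (by positivity) hδ.1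
  have hκ1 : 1 / (2 * lam) * δ ≤ 1 :=
    (mul_le_mul_of_nonneg_left hδ.2 (by positivity)).trans hκδ
  have hprob₁ := hπ₁.1
  have hprob₂ := hπ₂.1
  have hmom : ∀ D, PnPULA.LipschitzDenoiser D M → ∀ π : MeasureTheory.Measure _,
      PnPULA.IsInvariantLaw (PnPULA.drift p y S lam ε D) δ π →
      MeasureTheory.MemLp (fun x => x) 2 π := by
    intro D hD π hπ
    have := hπ.1
    -- The growth bound comes from comparing `x` with `0` in the contraction estimate.
    refine (hπ.isStationary (hcont D hD)).memLp_two
      (measurable_id.add ((hcont D hD).const_smul δ)) (q := 1 - 1 / (2 * lam) * δ)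
      (c := 1 / (2 * lam) * δ * (2 * Metric.diam S) + ‖δ • PnPULA.drift p y S lam ε D 0‖)
      (by linarith) (by linarith)
      (add_nonneg (mul_nonneg hκ0.le (mul_nonneg (by norm_num) Metric.diam_nonneg))
        (norm_nonneg _)) fun x => ?_
    have h1 := hcontr D hD x 0
    rw [zero_add, sub_zero] at h1
    have h2 := norm_sub_norm_le (x + δ • PnPULA.drift p y S lam ε D x)
      (δ • PnPULA.drift p y S lam ε D 0)
    linarith
  have hm₁ := hmom D₁ hD₁ π₁ hπ₁
  have hm₂ := hmom D₂ hD₂ π₂ hπ₂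
  have hsub := hD₁.memLp_sub hD₂ hm₁
  have hsubb : MeasureTheory.MemLp
      (fun x => PnPULA.drift p y S lam ε D₁ x - PnPULA.drift p y S lam ε D₂ x) 2 π₁ := by
    simp_rw [PnPULA.drift_sub_drift]
    exact hsub.const_smul (1 / ε)
  have htv : PnPULA.tvDist π₁ π₂ ≤
      A * PnPULA.d₁ π₁ (PnPULA.drift p y S lam ε D₁) (PnPULA.drift p y S lam ε D₂) := by
    refine PnPULA.tvDist_le fun φ hφ hφ1 => ?_
    refine (hmain δ hδ _ _ (hcont D₁ hD₁) (hcont D₂ hD₂)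
      (PnPULA.norm_add_smul_drift_sub_le hp hε hlam hSne hSconv hScomp hD₂ hδ.1) (hcontr D₂ hD₂)
      π₁ π₂ hprob₁ hprob₂ (hπ₁.isStationary (hcont D₁ hD₁)) (hπ₂.isStationary (hcont D₂ hD₂))
      (hm₁.integrable (by norm_num)).norm (hm₂.integrable (by norm_num)).norm
      (hsubb.integrable (by norm_num)).norm φ hφ hφ1).trans ?_
    exact mul_le_mul_of_nonneg_left (PnPULA.integral_norm_sub_le_d₁ hsubb) hA
  refine ⟨hsub.integrable_norm_pow (by norm_num), by simpa using htv, ?_⟩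
  rw [PnPULA.d₁_drift hε] at htv
  rw [zero_mul, add_zero]
  refine htv.trans_eq ?_
  ring
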